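/- Notation. Let $n\ge 2$, let $B^d$ be the open unit ball of $\mathbb{R}^d$, let $\phi\colon B^n\times B^{n-1}\to\mathbb{R}$ be smooth and let $a\in C_c^\infty(\mathbb{R}^n\times\mathbb{R}^{n-1})$ be complex-valued with support in $B^n\times B^{n-1}$. Put $G_0(x;\omega):=\bigwedge_{j=1}^{n-1}\partial_{\omega_j}\partial_x\phi(x;\omega)$ (identified with a vector of $\mathbb{R}^n$), $G:=G_0/|G_0|$, and let $M(x;\omega_0)$ be the symmetric matrix $\partial^2_{\omega\omega}\langle\partial_x\phi(x;\omega),G(x;\omega_0)\rangle|_{\omega=\omega_0}$. Assume H1) $\operatorname{rank}\partial^2_{\omega x}\phi(x;\omega)=n-1$ for all $(x;\omega)\in B^n\times B^{n-1}$; H2) $\det M(x;\omega_0)\neq 0$ for all $(x;\omega_0)\in\operatorname{supp}a$. For $\lambda>1$ and integrable $f\colon B^{n-1}\to\mathbb{C}$ set $$T^\lambda f(x):=\int_{B^{n-1}}e^{2\pi i\lambda\phi(x/\lambda;\omega)}\,a(x/\lambda;\omega)\,f(\omega)\,d\omega ,\qquad x\in\mathbb{R}^n.$$ Then $T^\lambda$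 is called a Hörmander-type operator. One says that $\operatorname{sgn}(\phi)=\sigma$ if the eigenvalues of $M$, counted with multiplicity, are given by $n-1$ continuous functions on $B^n\times B^{n-1}$ which are bounded away from $0$, of which $\sigma_+$ are positive and $\sigma_-$ are negative, with $|\sigma_+-\sigma_-|=\sigma$. Proposition 1.2. For every $n\ge2$ and every integer $0\le\sigma\le n-1$ such that $n-1-\sigma$ is even there exists a Hörmander-type operator with $\operatorname{sgn}(\phi)=\sigma$ such that, for every exponent $0<p<\infty$ which does not satisfy $$p\ \ge\ \begin{cases}2\cdot\dfrac{\sigma+2(n+1)}{\sigma+2(n-1)} & \text{if } n \text{ is odd},\\[8pt] 2\cdot\dfrac{\sigma+2n+3}{\sigma+2n-1} & \text{if } n\text{ is even},\end{cases}$$ the following statement is false: for all $\varepsilon>0$ there is a constant $C$ such that $$\|T^\lambda f\|_{L^p(\mathbb{R}^n)}\le C\,\lambda^\varepsilon\,\|f\|_{L^p(B^{n-1})}\qquad\text{for all }\lambda>1\text{ and all integrable } f\colon B^{n-1}\to\mathbb{C}.$$ -/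

import Mathlib

namespace HormanderOperator

/-- `ℝ^m` with its Euclidean norm and Lebesgue measure. -/
abbrev E (m : ℕ) : Type := EuclideanSpace ℝ (Fin m)

/-- The (open) unit ball `B^m` of `ℝ^m`. -/
abbrev B (m : ℕ) : Set (E m) := Metric.ball 0 1

/-- The partial derivative `∂_i f (x)` in the `i`-th coordinate. -/
noncomputable def pderiv {m : ℕ} (i : Fin m) (f : E m → ℝ) (x : E m) : ℝ :=
  lineDeriv ℝ f x (EuclideanSpace.single i (1 : ℝ))

/- Throughout, `d = n - 1`: a phase is a function `φ (x; ω)` of `x ∈ ℝ^n = ℝ^(d+1)` and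
`ω ∈ ℝ^(n-1) = ℝ^d`. Only its values on `B^n × B^(n-1)` are ever used; as this set is open, the
derivatives at its points only depend on these values. -/

/-- The gradient `∂_x φ (x; ω)`, a vector in `ℝ^n`. -/
noncomputable def gradX {d : ℕ} (φ : E (d + 1) → E d → ℝ) (x : E (d + 1)) (ω : E d) : E (d + 1) :=
  WithLp.toLp 2 fun k => pderiv k (fun y => φ y ω) x

/-- The `(n-1) × n` matrix `∂²_{ωx} φ (x; ω)`; its `j`-th row is the vector `∂_{ω_j} ∂_x φ`. -/
noncomputable def mixedHessian {d : ℕ} (φ : E (d + 1) → E d → ℝ) (x : E (d + 1)) (ω : E d) :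
    Matrix (Fin d) (Fin (d + 1)) ℝ :=
  Matrix.of fun j k => pderiv j (fun w => gradX φ x w k) ω

/-- `G₀ (x; ω) = ⋀_{j=1}^{n-1} ∂_{ω_j} ∂_x φ (x; ω)`, where the wedge product of `n - 1` vectors
`v_1, …, v_{n-1}` of `ℝ^n` is identified, as usual, with the vector whose inner product with any
`w` is `det (w, v_1, …, v_{n-1})`. Its `k`-th coordinate is found by taking `w` to be the `k`-th
basis vector. -/
noncomputable def G₀ {d : ℕ} (φ : E (d + 1) → E d → ℝ) (x : E (d + 1)) (ω : E d) : E (d + 1) :=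
  WithLp.toLp 2 fun k =>
    Matrix.det (Matrix.of
      (Fin.cons (Pi.single k 1) (fun j => mixedHessian φ x ω j) :
        Fin (d + 1) → Fin (d + 1) → ℝ))

/-- The unit normal `G (x; ω) = G₀ (x; ω) / |G₀ (x; ω)|`. -/
noncomputable def G {d : ℕ} (φ : E (d + 1) → E d → ℝ) (x : E (d + 1)) (ω : E d) : E (d + 1) :=
  ‖G₀ φ x ω‖⁻¹ • G₀ φ x ω

/-- The symmetric `(n-1) × (n-1)` matrix `∂²_{ωω} ⟨∂_x φ (x; ω), G (x; ω₀)⟩` at `ω = ω₀`. -/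
noncomputable def curvatureMatrix {d : ℕ} (φ : E (d + 1) → E d → ℝ) (x : E (d + 1)) (ω₀ : E d) :
    Matrix (Fin d) (Fin d) ℝ :=
  Matrix.of fun i j =>
    pderiv i (fun w => pderiv j (fun v => inner ℝ (gradX φ x v) (G φ x ω₀)) w) ω₀

/-- The phase `φ` and the amplitude `a` define a Hörmander-type operator in dimension
`n = d + 1`. -/
structure IsHormanderType {d : ℕ} (φ : E (d + 1) → E d → ℝ) (a : E (d + 1) → E d → ℂ) : Prop where
  /-- the phase is smooth on `B^n × B^(n-1)` -/
  phase_smooth : ContDiffOn ℝ ((⊤ : ℕ∞) : WithTop ℕ∞) (Function.uncurry φ) (B (d + 1) ×ˢ B d)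
  /-- the amplitude is smooth -/
  amplitude_smooth : ContDiff ℝ ((⊤ : ℕ∞) : WithTop ℕ∞) (Function.uncurry a)
  /-- the amplitude has compact support -/
  amplitude_compact : HasCompactSupport (Function.uncurry a)
  /-- the amplitude is supported in `B^n × B^(n-1)` -/
  amplitude_support : tsupport (Function.uncurry a) ⊆ B (d + 1) ×ˢ B d
  /-- condition H1) -/
  rank_eq : ∀ x ∈ B (d + 1), ∀ ω ∈ B d, (mixedHessian φ x ω).rank = d
  /-- condition H2) -/
  det_ne_zero : ∀ z ∈ tsupport (Function.uncurry a), (curvatureMatrix φ z.1 z.2).det ≠ 0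

/-- `sgn(φ) = σ`: the eigenvalues of the curvature matrix, listed with multiplicity, are given by
continuous functions `μ_1, …, μ_{n-1}` on `B^n × B^(n-1)` which are bounded away from `0`, and
`|σ₊ - σ₋| = σ` where `σ₊` and `σ₋` are the numbers of positive and of negative functions among
the `μ_i`. (On the connected set `B^n × B^(n-1)` each `μ_i` has constant sign, so the two numbers
may be computed at any point.) -/
def HasSignature {d : ℕ} (φ : E (d + 1) → E d → ℝ) (σ : ℕ) : Prop :=
  ∃ μ : Fin d → E (d + 1) × E d → ℝ,
    (∀ i, ContinuousOn (μ i) (B (d + 1) ×ˢ B d)) ∧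
    (∃ c > 0, ∀ i, ∀ z ∈ B (d + 1) ×ˢ B d, c ≤ |μ i z|) ∧
    (∀ z ∈ B (d + 1) ×ˢ B d,
      (curvatureMatrix φ z.1 z.2).charpoly =
        ∏ i, (Polynomial.X - Polynomial.C (μ i z))) ∧
    (∀ z ∈ B (d + 1) ×ˢ B d,
      |((Finset.univ.filter fun i => 0 < μ i z).card : ℤ) -
        ((Finset.univ.filter fun i => μ i z < 0).card : ℤ)| = (σ : ℤ))

/-- The operator `T^λ f (x) = ∫_{B^(n-1)} e^{2πi φ^λ(x; ω)} a^λ(x; ω) f(ω) dω`, where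
`φ^λ(x; ω) = λ φ(x/λ; ω)` and `a^λ(x; ω) = a(x/λ; ω)`. -/
noncomputable def T {d : ℕ} (φ : E (d + 1) → E d → ℝ) (a : E (d + 1) → E d → ℂ) (lam : ℝ)
    (f : E d → ℂ) (x : E (d + 1)) : ℂ :=
  ∫ ω in B d,
    Complex.exp (2 * Real.pi * Complex.I * ((lam * φ (lam⁻¹ • x) ω : ℝ) : ℂ)) *
      a (lam⁻¹ • x) ω * f ω

/-- The `L^p` estimate with `ε`-loss: for every `ε > 0` there is a constant `C`
(depending on `ε`, `φ`, `a`, `n`, `p` only) such that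
`‖T^λ f‖_{L^p(ℝ^n)} ≤ C λ^ε ‖f‖_{L^p(B^(n-1))}` for all `λ > 1` and all integrable `f`. -/
def EpsLossEstimate {d : ℕ} (φ : E (d + 1) → E d → ℝ) (a : E (d + 1) → E d → ℂ) (p : ℝ) : Prop :=
  ∀ ε : ℝ, 0 < ε → ∃ C : ℝ, 0 ≤ C ∧ ∀ lam : ℝ, 1 < lam → ∀ f : E d → ℂ,
    MeasureTheory.IntegrableOn f (B d) MeasureTheory.volume →
      MeasureTheory.eLpNorm (T φ a lam f) (ENNReal.ofReal p) MeasureTheory.volume ≤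
        ENNReal.ofReal (C * lam ^ ε) *
          MeasureTheory.eLpNorm f (ENNReal.ofReal p) (MeasureTheory.volume.restrict (B d))

/-- The endpoint of the range of exponents in dimension `n` and signature `σ`. -/
noncomputable def criticalExponent (n σ : ℕ) : ℝ :=
  if Odd n then 2 * (((σ : ℝ) + 2 * ((n : ℝ) + 1)) / ((σ : ℝ) + 2 * ((n : ℝ) - 1)))
  else 2 * (((σ : ℝ) + 2 * (n : ℝ) + 3) / ((σ : ℝ) + 2 * (n : ℝ) - 1))

end HormanderOperator

open scoped SchwartzMap FourierTransform LineDeriv ENNReal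
open MeasureTheory

namespace HormanderOperator

/-! The coefficients of the quadratic phase are `± e^{± x₀}`, and the coordinates of `ω` are grouped
into pairs `(u, v)` of indices `(2m, 2m + 1)`. The curvature sees only the derivatives of the
coefficients, whereas the coefficients themselves decide where waves focus; choosing signs and rates
separately prescribes the signature and still forces focusing. Put `λ = N²` and `τ = x₀ / λ`.

In each of the first `k` pairs the form is `½(e^τ u² + e^{-τ} v²)`, whose `τ`-derivative is
indefinite. Multiplying the input by a fixed factor of phase `uv` makes it `½(e^{τ/2} u + e^{-τ/2}
v)²`, which has rank one at every time, so the image concentrates on a strip of size `λ × 1` in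
these two variables. In the other pairs the form is `½(e^τ u² - e^{-τ} v²)`, with positive definite
derivative. There the frequencies are cut into tiles of side about `1/N`, and a linear phase on the
tile centred at `(a, b)` makes the gradient at the centre `(e^τ a - b, a - e^{-τ} b)`. This is
always parallel to `(1, e^{-τ})`, so all tubes are compressed into one strip of size `λ × λ^{1/2}`,
as in a Kakeya compression. An unpaired coordinate contributes a side `λ`.

The algebra behind both cases is `slope_combination_of_odd`; `half_le_lintegral_fourierInv` turns it
into `L²` concentration by Plancherel and Chebyshev. With signs from `exists_sign_sum_lintegral_le`,
the wave packets add up in `exists_concentrated_input` to an input bounded by `1` whose image has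
mass at least a multiple of `N²` on a set of volume `O(N^(S+2))`, where `S` is the sum of the
exponents of the sides. If `p > 2`, Hölder's inequality and the estimate give `N ≲ N^(2ε + (S+2)(1/2
- 1/p))`, which fails for small `ε` when `p S < 2 (S + 2)`; inserting `k = (n - 1 - σ)/2` gives the
critical exponent. If `p ≤ 2`, the trivial sup bound on the image suffices. -/

/-! ### The phase: rank, curvature and signature -/

/-- The sign of the `i`-th quadratic coefficient of the phase. -/
noncomputable def profileSign (k i : ℕ) : ℝ := if Odd i ∧ 2 * k ≤ i then -1 else 1

/-- The growth rate of the `i`-th quadratic coefficient of the phase. -/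
noncomputable def profileRate (i : ℕ) : ℝ := if Even i then 1 else -1

/-- The `i`-th quadratic coefficient of the phase, as a function of time. -/
noncomputable def profile (k i : ℕ) (τ : ℝ) : ℝ := profileSign k i * Real.exp (profileRate i * τ)

/-- The translation invariant phase `⟨x', ω⟩ + ½ ∑ hᵢ(x₀) ωᵢ²`, where `x = (x₀, x')`. -/
noncomputable def phase (d k : ℕ) (x : E (d + 1)) (ω : E d) : ℝ :=
  ∑ i : Fin d, x i.succ * ω i + (1 / 2) * ∑ i : Fin d, profile k i (x 0) * ω i ^ 2

theorem hasDerivAt_profile (k i : ℕ) (τ : ℝ) :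
    HasDerivAt (profile k i) (profileRate i * profile k i τ) τ := by
  have h := (((hasDerivAt_id τ).const_mul (profileRate i)).exp).const_mul (profileSign k i)
  refine h.congr_deriv ?_
  simp only [profile, id]; ring

theorem contDiff_profile (k i : ℕ) {m : WithTop ℕ∞} : ContDiff ℝ m (profile k i) := by
  unfold profile; fun_prop

theorem contDiff_phase (d k : ℕ) {m : WithTop ℕ∞} :
    ContDiff ℝ m (Function.uncurry (phase d k)) := by
  have h0 : ∀ i : Fin (d + 1), ContDiff ℝ m (fun z : E (d + 1) × E d => z.1 i) := fun i => by
    fun_prop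
  have h1 : ∀ i : Fin d, ContDiff ℝ m (fun z : E (d + 1) × E d => z.2 i) := fun i => by fun_prop
  unfold phase Function.uncurry
  refine ContDiff.add (ContDiff.sum fun i _ => (h0 _).mul (h1 _)) (contDiff_const.mul ?_)
  exact ContDiff.sum fun i _ => ((contDiff_profile k i).comp (h0 0)).mul ((h1 i).pow 2)

theorem gradX_phase_succ (d k : ℕ) (x : E (d + 1)) (ω : E d) (i : Fin d) :
    gradX (phase d k) x ω i.succ = ω i := by
  have h : HasLineDerivAt ℝ (fun y => phase d k y ω) (ω i) x
      (EuclideanSpace.single i.succ (1 : ℝ)) := by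
    unfold HasLineDerivAt
    have h1 : ∀ t : ℝ, phase d k (x + t • EuclideanSpace.single i.succ (1 : ℝ)) ω =
        phase d k x ω + t * ω i := by
      intro t
      simp only [phase, PiLp.add_apply, PiLp.smul_apply, PiLp.single_apply,
        Fin.succ_inj, smul_eq_mul, mul_ite, mul_one, mul_zero, add_mul, ite_mul, zero_mul,
        Finset.sum_add_distrib, Finset.sum_ite_eq', Finset.mem_univ, if_true,
        (Fin.succ_ne_zero i).symm, if_false, add_zero]
      ring
    simp only [h1]
    simpa using ((hasDerivAt_id (0 : ℝ)).mul_const (ω i)).const_add (phase d k x ω)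
  exact h.lineDeriv

theorem gradX_phase_zero (d k : ℕ) (x : E (d + 1)) (ω : E d) :
    gradX (phase d k) x ω 0 =
      (1 / 2) * ∑ i : Fin d, profileRate i * profile k i (x 0) * ω i ^ 2 := by
  have h : HasLineDerivAt ℝ (fun y => phase d k y ω)
      ((1 / 2) * ∑ i : Fin d, profileRate i * profile k i (x 0) * ω i ^ 2) x
      (EuclideanSpace.single 0 (1 : ℝ)) := by
    unfold HasLineDerivAt
    have h1 : ∀ t : ℝ, phase d k (x + t • EuclideanSpace.single 0 (1 : ℝ)) ω =
        ∑ i : Fin d, x i.succ * ω i +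
          (1 / 2) * ∑ i : Fin d, profile k i (x 0 + t) * ω i ^ 2 := by
      intro t
      simp [phase, Fin.succ_ne_zero]
    simp only [h1]
    refine HasDerivAt.const_add _ (HasDerivAt.const_mul _ ?_)
    refine HasDerivAt.fun_sum fun i _ => HasDerivAt.mul_const ?_ _
    have := (hasDerivAt_profile k i (x 0 + 0)).comp_const_add (x 0) 0
    simpa using this
  exact h.lineDeriv

theorem pderiv_coord {m : ℕ} (i j : Fin m) (ω : E m) :
    pderiv j (fun w : E m => w i) ω = if i = j then 1 else 0 := by
  have h : HasLineDerivAt ℝ (fun w : E m => w i) (if i = j then 1 else 0) ω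
      (EuclideanSpace.single j (1 : ℝ)) := by
    unfold HasLineDerivAt
    simp only [PiLp.add_apply, PiLp.smul_apply, PiLp.single_apply, smul_eq_mul]
    simpa using ((hasDerivAt_id (0 : ℝ)).mul_const (if i = j then (1:ℝ) else 0)).const_add (ω i)
  exact h.lineDeriv

theorem pderiv_half_sum_sq {m : ℕ} (c : Fin m → ℝ) (j : Fin m) (ω : E m) :
    pderiv j (fun w : E m => (1 / 2) * ∑ i, c i * w i ^ 2) ω = c j * ω j := by
  have h : HasLineDerivAt ℝ (fun w : E m => (1 / 2) * ∑ i, c i * w i ^ 2) (c j * ω j) ω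
      (EuclideanSpace.single j (1 : ℝ)) := by
    unfold HasLineDerivAt
    simp only [PiLp.add_apply, PiLp.smul_apply, PiLp.single_apply, smul_eq_mul]
    have h2 : ∀ i : Fin m, HasDerivAt (fun t : ℝ => c i * (ω i + t * if i = j then 1 else 0) ^ 2)
        (if i = j then 2 * (c j * ω j) else 0) 0 := by
      intro i
      have := ((((hasDerivAt_id (0 : ℝ)).mul_const (if i = j then (1:ℝ) else 0)).const_add
        (ω i)).pow 2).const_mul (c i)
      refine this.congr_deriv ?_
      split_ifs with hij
      · subst hij; simp; ring
      · simp
    have h3 := (HasDerivAt.fun_sum (u := Finset.univ) fun i _ => h2 i).const_mul (1 / 2 : ℝ)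
    refine h3.congr_deriv ?_
    simp
  exact h.lineDeriv

theorem mixedHessian_phase_succ (d k : ℕ) (x : E (d + 1)) (ω : E d) (j i : Fin d) :
    mixedHessian (phase d k) x ω j i.succ = if i = j then 1 else 0 := by
  simp only [mixedHessian, Matrix.of_apply, gradX_phase_succ, pderiv_coord]

theorem mixedHessian_phase_zero (d k : ℕ) (x : E (d + 1)) (ω : E d) (j : Fin d) :
    mixedHessian (phase d k) x ω j 0 = profileRate j * profile k j (x 0) * ω j := by
  simp only [mixedHessian, Matrix.of_apply, gradX_phase_zero]
  exact pderiv_half_sum_sq (fun i : Fin d => profileRate i * profile k i (x 0)) j ω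

theorem rank_mixedHessian_phase (d k : ℕ) (x : E (d + 1)) (ω : E d) :
    (mixedHessian (phase d k) x ω).rank = d := by
  refine le_antisymm (by simpa using Matrix.rank_le_height (mixedHessian (phase d k) x ω)) ?_
  -- Deleting the column of `x₀` leaves the identity, so the matrix has a right inverse.
  have h : mixedHessian (phase d k) x ω *
      (Matrix.of fun (a : Fin (d + 1)) (b : Fin d) => if a = b.succ then (1 : ℝ) else 0) = 1 := by
    ext i j
    rw [Matrix.mul_apply, Fin.sum_univ_succ]
    simp [mixedHessian_phase_succ, Matrix.one_apply, (Fin.succ_ne_zero _).symm,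
      eq_comm]
  have h2 := Matrix.rank_mul_le_left (mixedHessian (phase d k) x ω)
    (Matrix.of fun (a : Fin (d + 1)) (b : Fin d) => if a = b.succ then (1 : ℝ) else 0)
  rw [h, Matrix.rank_one, Fintype.card_fin] at h2
  exact h2

/-- The minor of the mixed Hessian without the column of `x₀` is the identity. In particular `G₀`
never vanishes, so `G` is a genuine unit vector. -/
theorem G₀_phase_zero (d k : ℕ) (x : E (d + 1)) (ω : E d) : G₀ (phase d k) x ω 0 = 1 := by
  have key : ∀ M : Matrix (Fin (d + 1)) (Fin (d + 1)) ℝ, M 0 = Pi.single 0 1 →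
      (∀ j : Fin d, M j.succ = mixedHessian (phase d k) x ω j) → M.det = 1 := by
    intro M h0 hs
    have h : M.submatrix Fin.succ (Fin.succAbove 0) = 1 := by
      ext i j
      simp [hs, mixedHessian_phase_succ, Matrix.one_apply, eq_comm]
    rw [Matrix.det_succ_row_zero, Fin.sum_univ_succ, h]
    simp [h0]
  exact key _ rfl fun _ => rfl

theorem continuous_mixedHessian_phase (d k : ℕ) (j : Fin d) (l : Fin (d + 1)) :
    Continuous fun z : E (d + 1) × E d => mixedHessian (phase d k) z.1 z.2 j l := by
  have h := (contDiff_profile k j (m := 0)).continuous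
  refine Fin.cases ?_ (fun i => ?_) l
  · simp only [mixedHessian_phase_zero]
    fun_prop
  · simp only [mixedHessian_phase_succ]
    exact continuous_const

theorem continuous_G₀_phase (d k : ℕ) :
    Continuous fun z : E (d + 1) × E d => G₀ (phase d k) z.1 z.2 := by
  refine (PiLp.continuous_toLp 2 _).comp (continuous_pi fun l => ?_)
  refine Continuous.matrix_det (continuous_matrix fun i j => ?_)
  refine Fin.cases ?_ (fun i => ?_) i
  · simp only [Matrix.of_apply, Fin.cons_zero]
    exact continuous_const
  · simp only [Matrix.of_apply, Fin.cons_succ]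
    exact continuous_mixedHessian_phase d k i j

theorem G₀_phase_norm_pos (d k : ℕ) (x : E (d + 1)) (ω : E d) : 0 < ‖G₀ (phase d k) x ω‖ := by
  rw [norm_pos_iff]
  intro h
  have := G₀_phase_zero d k x ω
  rw [h] at this
  simp at this

/-- Pairing the gradient with a fixed vector gives a linear function of `ω`, which two derivatives
kill, plus the `x₀`-component times the derivative of the quadratic form, which is diagonal. -/
theorem curvatureMatrix_phase (d k : ℕ) (x : E (d + 1)) (ω : E d) :
    curvatureMatrix (phase d k) x ω = Matrix.diagonal fun i : Fin d =>
      ‖G₀ (phase d k) x ω‖⁻¹ * (profileRate i * profile k i (x 0)) := by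
  ext i j
  set g := G (phase d k) x ω with hg
  have hg0 : g 0 = ‖G₀ (phase d k) x ω‖⁻¹ := by
    simp [hg, G, G₀_phase_zero]
  have h1 : ∀ v : E d, inner ℝ (gradX (phase d k) x v) g =
      ∑ l : Fin d, g l.succ * v l +
        (1 / 2) * ∑ l : Fin d, g 0 * (profileRate l * profile k l (x 0)) * v l ^ 2 := by
    intro v
    rw [PiLp.inner_apply, Fin.sum_univ_succ]
    simp only [gradX_phase_zero, gradX_phase_succ, RCLike.inner_apply, conj_trivial]
    simp only [mul_assoc, ← Finset.mul_sum]
    ring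
  have h2 : ∀ w : E d, pderiv j (fun v => inner ℝ (gradX (phase d k) x v) g) w =
      g j.succ + g 0 * (profileRate j * profile k j (x 0)) * w j := by
    intro w
    simp only [h1]
    have ha : LineDifferentiableAt ℝ (fun v : E d => ∑ l : Fin d, g l.succ * v l) w
        (EuclideanSpace.single j (1 : ℝ)) := by
      refine DifferentiableAt.lineDifferentiableAt ?_
      fun_prop
    have hb : LineDifferentiableAt ℝ (fun v : E d => (1 / 2) * ∑ l : Fin d,
        g 0 * (profileRate l * profile k l (x 0)) * v l ^ 2) w
        (EuclideanSpace.single j (1 : ℝ)) := by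
      refine DifferentiableAt.lineDifferentiableAt ?_
      fun_prop
    have hc : lineDeriv ℝ (fun v : E d => ∑ l : Fin d, g l.succ * v l) w
        (EuclideanSpace.single j (1 : ℝ)) = g j.succ := by
      have : HasLineDerivAt ℝ (fun v : E d => ∑ l : Fin d, g l.succ * v l) (g j.succ) w
          (EuclideanSpace.single j (1 : ℝ)) := by
        unfold HasLineDerivAt
        simp only [PiLp.add_apply, PiLp.smul_apply, PiLp.single_apply, smul_eq_mul,
          mul_add, Finset.sum_add_distrib, mul_ite, mul_one, mul_zero, Finset.sum_ite_eq',
          Finset.mem_univ, if_true]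
        simpa using ((hasDerivAt_id (0 : ℝ)).const_mul (g j.succ)).const_add
          (∑ l : Fin d, g l.succ * w l)
      exact this.lineDeriv
    have hd := pderiv_half_sum_sq
      (fun l : Fin d => g 0 * (profileRate l * profile k l (x 0))) j w
    have he : HasLineDerivAt ℝ (fun v : E d => ∑ l : Fin d, g l.succ * v l +
        (1 / 2) * ∑ l : Fin d, g 0 * (profileRate l * profile k l (x 0)) * v l ^ 2) _ w
        (EuclideanSpace.single j (1 : ℝ)) := HasDerivAt.add ha.hasLineDerivAt hb.hasLineDerivAt
    unfold pderiv at hd ⊢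
    rw [hc, hd] at he
    exact he.lineDeriv
  simp only [curvatureMatrix, Matrix.of_apply, ← hg, h2]
  have h3 : HasLineDerivAt ℝ (fun w : E d => g j.succ + g 0 *
      (profileRate j * profile k j (x 0)) * w j)
      (g 0 * (profileRate j * profile k j (x 0)) * if j = i then 1 else 0) ω
      (EuclideanSpace.single i (1 : ℝ)) := by
    unfold HasLineDerivAt
    simp only [PiLp.add_apply, PiLp.smul_apply, PiLp.single_apply, smul_eq_mul]
    refine HasDerivAt.const_add _ (HasDerivAt.const_mul _ ?_)
    simpa using ((hasDerivAt_id (0 : ℝ)).mul_const (if j = i then (1:ℝ) else 0)).const_add (ω j)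
  have h4 := h3.lineDeriv
  unfold pderiv
  rw [h4, Matrix.diagonal_apply, hg0]
  split_ifs with ha hb hb
  · subst ha; ring
  · exact absurd ha.symm hb
  · exact absurd hb.symm ha
  · simp

theorem profileRate_mul_profile_abs (k i : ℕ) (τ : ℝ) :
    |profileRate i * profile k i τ| = Real.exp (profileRate i * τ) := by
  have h1 : |profileRate i| = 1 := by unfold profileRate; split_ifs <;> simp
  have h2 : |profileSign k i| = 1 := by unfold profileSign; split_ifs <;> simp
  rw [profile, abs_mul, abs_mul, h1, h2, abs_of_pos (Real.exp_pos _)]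
  ring

theorem profileRate_abs (i : ℕ) : |profileRate i| = 1 := by
  unfold profileRate; split_ifs <;> simp

theorem exp_neg_one_le_exp_profileRate (i : ℕ) {τ : ℝ} (h : |τ| ≤ 1) :
    Real.exp (-1) ≤ Real.exp (profileRate i * τ) := by
  refine Real.exp_le_exp.2 ?_
  have : |profileRate i * τ| ≤ 1 := by rw [abs_mul, profileRate_abs, one_mul]; exact h
  exact (abs_le.1 this).1

theorem card_filter_odd_lt (d k : ℕ) (h : 2 * k ≤ d) :
    (Finset.univ.filter fun i : Fin d => Odd (i : ℕ) ∧ (i : ℕ) < 2 * k).card = k := by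
  have h1 : (Finset.univ.filter fun i : Fin d => Odd (i : ℕ) ∧ (i : ℕ) < 2 * k).card =
      (Finset.range k).card := by
    symm
    refine Finset.card_bij (fun a ha => ⟨2 * a + 1, ?_⟩) ?_ ?_ ?_
    · have := Finset.mem_range.1 ha; omega
    · intro a ha
      have := Finset.mem_range.1 ha
      simp; omega
    · intro a _ b _ hab
      simp at hab; exact hab
    · intro b hb
      simp only [Finset.mem_filter, Finset.mem_univ, true_and] at hb
      obtain ⟨⟨m, hm⟩, hb2⟩ := hb
      refine ⟨m, Finset.mem_range.2 (by omega), ?_⟩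
      ext; simp [hm]
  rw [h1, Finset.card_range]

/-- These are the signs of the derivatives of the coefficients: negative exactly once in each of the
first `k` pairs, although all coefficients of those pairs are positive. -/
theorem profileRate_mul_profileSign (k i : ℕ) :
    profileRate i * profileSign k i = if Odd i ∧ i < 2 * k then -1 else 1 := by
  unfold profileRate profileSign
  rcases Nat.even_or_odd i with h | h
  · simp [h, Nat.not_odd_iff_even.2 h]
  · by_cases h2 : i < 2 * k
    · simp [h, Nat.not_even_iff_odd.2 h, h2]
    · simp [h, Nat.not_even_iff_odd.2 h, h2, not_lt.1 h2]

theorem hasSignature_phase (d k σ : ℕ) (h : d = 2 * k + σ) : HasSignature (phase d k) σ := by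
  have hcont : Continuous fun z : E (d + 1) × E d => ‖G₀ (phase d k) z.1 z.2‖⁻¹ :=
    (continuous_G₀_phase d k).norm.inv₀ fun z => (G₀_phase_norm_pos d k z.1 z.2).ne'
  -- An upper bound for the normalising factor on the compact closed balls keeps the eigenvalues
  -- away from `0`.
  obtain ⟨C, hC⟩ : ∃ C : ℝ, ∀ z ∈ B (d + 1) ×ˢ B d, ‖G₀ (phase d k) z.1 z.2‖ ≤ C := by
    obtain ⟨C, hC⟩ := ((isCompact_closedBall (0 : E (d + 1)) 1).prod
      (isCompact_closedBall (0 : E d) 1)).exists_bound_of_continuousOn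
      (continuous_G₀_phase d k).continuousOn
    exact ⟨C, fun z hz => hC z ⟨Metric.ball_subset_closedBall hz.1,
      Metric.ball_subset_closedBall hz.2⟩⟩
  have hC0 : 0 < C := (G₀_phase_norm_pos d k 0 0).trans_le
    (hC (0, 0) ⟨Metric.mem_ball_self one_pos, Metric.mem_ball_self one_pos⟩)
  have hsign : ∀ (i : Fin d) (z : E (d + 1) × E d),
      ‖G₀ (phase d k) z.1 z.2‖⁻¹ * (profileRate i * profile k i (z.1 0)) =
        (if Odd (i : ℕ) ∧ (i : ℕ) < 2 * k then -1 else 1) *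
          (‖G₀ (phase d k) z.1 z.2‖⁻¹ * Real.exp (profileRate i * z.1 0)) := by
    intro i z
    rw [← profileRate_mul_profileSign, profile]; ring
  have hpos : ∀ (i : Fin d) (z : E (d + 1) × E d),
      0 < ‖G₀ (phase d k) z.1 z.2‖⁻¹ * Real.exp (profileRate i * z.1 0) := fun i z =>
    mul_pos (inv_pos.2 (G₀_phase_norm_pos d k z.1 z.2)) (Real.exp_pos _)
  refine ⟨fun i z => ‖G₀ (phase d k) z.1 z.2‖⁻¹ * (profileRate i * profile k i (z.1 0)),
    fun i => ?_, ⟨C⁻¹ * Real.exp (-1), by positivity, fun i z hz => ?_⟩, fun z _ => ?_,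
    fun z _ => ?_⟩
  · have h := (contDiff_profile k i (m := 0)).continuous
    refine Continuous.continuousOn ?_
    fun_prop
  · rw [abs_mul, profileRate_mul_profile_abs, abs_of_pos (inv_pos.2 (G₀_phase_norm_pos d k _ _))]
    have h0 : |z.1 0| ≤ 1 :=
      (PiLp.norm_apply_le z.1 0).trans (mem_ball_zero_iff.1 hz.1).le
    have h1 := exp_neg_one_le_exp_profileRate i h0
    have h2 := G₀_phase_norm_pos d k z.1 z.2
    have h3 := hC z hz
    gcongr
  · rw [curvatureMatrix_phase, Matrix.charpoly_diagonal]
  · have hneg : (Finset.univ.filter fun i : Fin d =>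
        ‖G₀ (phase d k) z.1 z.2‖⁻¹ * (profileRate i * profile k i (z.1 0)) < 0) =
        Finset.univ.filter fun i : Fin d => Odd (i : ℕ) ∧ (i : ℕ) < 2 * k := by
      refine Finset.filter_congr fun i _ => ?_
      rw [hsign]
      have := hpos i z
      split_ifs with hi
      · simp [hi, this]
      · simp [hi, this.le]
    have hp : (Finset.univ.filter fun i : Fin d =>
        0 < ‖G₀ (phase d k) z.1 z.2‖⁻¹ * (profileRate i * profile k i (z.1 0))) =
        Finset.univ.filter fun i : Fin d => ¬(Odd (i : ℕ) ∧ (i : ℕ) < 2 * k) := by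
      refine Finset.filter_congr fun i _ => ?_
      rw [hsign]
      have := hpos i z
      split_ifs with hi
      · simp [hi, this.le]
      · simp [hi, this]
    have hcard := card_filter_odd_lt d k (by omega)
    have htot := Finset.card_filter_add_card_filter_not (s := (Finset.univ : Finset (Fin d)))
      (fun i : Fin d => Odd (i : ℕ) ∧ (i : ℕ) < 2 * k)
    simp only [hneg, hp]
    rw [hcard, Finset.card_univ, Fintype.card_fin] at htot
    rw [hcard]
    have : ((Finset.univ.filter fun i : Fin d => ¬(Odd (i : ℕ) ∧ (i : ℕ) < 2 * k)).card : ℤ) -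
        (k : ℤ) = σ := by omega
    rw [this]; simp

/-! ### The amplitude -/

/-- A smooth cutoff on `ℝ^m`, equal to `1` on the ball of radius `1/2`. -/
noncomputable def cutoff (m : ℕ) : ContDiffBump (0 : E m) := ⟨1 / 2, 3 / 4, by norm_num, by norm_num⟩

/-- The amplitude: a product of two cutoffs. -/
noncomputable def amplitude (d : ℕ) (x : E (d + 1)) (ω : E d) : ℂ :=
  ((cutoff (d + 1) x * cutoff d ω : ℝ) : ℂ)

theorem contDiff_amplitude (d : ℕ) {m : ℕ∞} :
    ContDiff ℝ m (Function.uncurry (amplitude d)) := by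
  have h1 := (cutoff (d + 1)).contDiff (n := m)
  have h2 := (cutoff d).contDiff (n := m)
  exact Complex.ofRealCLM.contDiff.comp ((h1.comp contDiff_fst).mul (h2.comp contDiff_snd))

theorem tsupport_amplitude_subset (d : ℕ) :
    tsupport (Function.uncurry (amplitude d)) ⊆
      Metric.closedBall 0 (3 / 4) ×ˢ Metric.closedBall 0 (3 / 4) := by
  refine closure_minimal ?_ (Metric.isClosed_closedBall.prod Metric.isClosed_closedBall)
  intro z hz
  have hne : amplitude d z.1 z.2 ≠ 0 := hz
  simp only [amplitude, Complex.ofReal_mul, mul_ne_zero_iff, Complex.ofReal_ne_zero] at hne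
  exact ⟨Metric.ball_subset_closedBall ((cutoff (d + 1)).support_eq ▸ hne.1),
    Metric.ball_subset_closedBall ((cutoff d).support_eq ▸ hne.2)⟩

theorem isHormanderType_phase_amplitude (d k : ℕ) : IsHormanderType (phase d k) (amplitude d) where
  phase_smooth := (contDiff_phase d k).contDiffOn
  amplitude_smooth := contDiff_amplitude d
  amplitude_compact := HasCompactSupport.of_support_subset_isCompact
    ((isCompact_closedBall _ _).prod (isCompact_closedBall _ _))
    (subset_closure.trans (tsupport_amplitude_subset d))
  amplitude_support := (tsupport_amplitude_subset d).trans (Set.prod_mono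
    (Metric.closedBall_subset_ball (by norm_num)) (Metric.closedBall_subset_ball (by norm_num)))
  rank_eq := fun x _ ω _ => rank_mixedHessian_phase d k x ω
  det_ne_zero := fun z _ => by
    rw [curvatureMatrix_phase, Matrix.det_diagonal, Finset.prod_ne_zero_iff]
    intro i _
    refine mul_ne_zero (inv_ne_zero (G₀_phase_norm_pos d k _ _).ne') ?_
    rw [← abs_ne_zero, profileRate_mul_profile_abs]
    exact (Real.exp_pos _).ne'

/-! ### Concentration in `L²` of inverse Fourier transforms -/

section Fourier

variable {V : Type*} [NormedAddCommGroup V] [InnerProductSpace ℝ V] [FiniteDimensional ℝ V]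
  [MeasurableSpace V] [BorelSpace V]

theorem ofReal_integral_norm_sq_schwartz (g : 𝓢(V, ℂ)) :
    ENNReal.ofReal (∫ x, ‖g x‖ ^ 2) = ∫⁻ x, ‖g x‖ₑ ^ 2 := by
  rw [ofReal_integral_eq_lintegral_ofReal]
  · refine lintegral_congr fun x => ?_
    rw [ENNReal.ofReal_pow (norm_nonneg _), ofReal_norm]
  · have h := (g.memLp 2 (μ := volume)).integrable_norm_pow (by norm_num)
    simpa using h
  · exact Filter.Eventually.of_forall fun x => by positivity

/-- Plancherel's identity for the inverse Fourier transform of a Schwartz function. -/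
theorem lintegral_enorm_sq_fourierInv (g : 𝓢(V, ℂ)) :
    ∫⁻ x, ‖𝓕⁻ g x‖ₑ ^ 2 = ∫⁻ x, ‖g x‖ₑ ^ 2 := by
  rw [← ofReal_integral_norm_sq_schwartz, ← ofReal_integral_norm_sq_schwartz,
    ← SchwartzMap.integral_norm_sq_fourier (𝓕⁻ g)]
  simp

theorem enorm_fourierInv_lineDeriv (g : 𝓢(V, ℂ)) (v x : V) :
    ‖𝓕⁻ (∂_{v} g) x‖ₑ ^ 2 =
      ENNReal.ofReal ((2 * Real.pi * |inner ℝ x v|) ^ 2) * ‖𝓕⁻ g x‖ₑ ^ 2 := by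
  have ht : (inner ℝ · v : V → ℝ).HasTemperateGrowth := by fun_prop
  rw [SchwartzMap.fourierInv_lineDerivOp_eq]
  simp only [_root_.smul_apply, SchwartzMap.smulLeftCLM_apply_apply ht]
  rw [← ofReal_norm, ← ofReal_norm, ← ENNReal.ofReal_pow (by positivity),
    ← ENNReal.ofReal_pow (by positivity), ← ENNReal.ofReal_mul (by positivity)]
  congr 1
  rw [norm_smul, norm_smul]
  simp only [norm_neg, norm_mul, Complex.norm_I, Complex.norm_real, Real.norm_eq_abs,
    abs_of_pos Real.pi_pos, Complex.norm_ofNat]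
  ring

/-- If the derivatives of `g` in the directions `v i` are small compared to `K i`, then at least
half of the `L²` mass of the inverse Fourier transform lies where `|⟪x, v i⟫| ≤ K i`. -/
theorem half_le_lintegral_fourierInv {ι : Type*} [Fintype ι] (g : 𝓢(V, ℂ)) (v : ι → V)
    (K : ι → ℝ) (hK : ∀ i, 0 < K i) (A : ℝ) (hA : 0 ≤ A)
    (hg : ENNReal.ofReal A ≤ ∫⁻ x, ‖g x‖ₑ ^ 2)
    (hd : ∀ i, ∫⁻ x, ‖∂_{v i} g x‖ₑ ^ 2 ≤
      ENNReal.ofReal ((2 * Real.pi * K i) ^ 2 * (A / (2 * Fintype.card ι)))) :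
    ENNReal.ofReal (A / 2) ≤ ∫⁻ x in {x | ∀ i, |inner ℝ x (v i)| ≤ K i}, ‖𝓕⁻ g x‖ₑ ^ 2 := by
  set U : Set V := {x | ∀ i, |inner ℝ x (v i)| ≤ K i} with hU
  have hUm : MeasurableSet U := by
    rw [hU, Set.ofPred_forall]
    exact MeasurableSet.iInter fun i =>
      (isClosed_le (by fun_prop) continuous_const).measurableSet
  have htail : ∀ i, ∫⁻ x, ENNReal.ofReal ((2 * Real.pi * K i) ^ 2)⁻¹ *
      ‖𝓕⁻ (∂_{v i} g) x‖ₑ ^ 2 ≤ ENNReal.ofReal (A / (2 * Fintype.card ι)) := by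
    intro i
    have hKi := hK i
    rw [lintegral_const_mul' _ _ ENNReal.ofReal_ne_top, lintegral_enorm_sq_fourierInv]
    refine (mul_le_mul_right (hd i) _).trans ?_
    rw [← ENNReal.ofReal_mul (by positivity)]
    refine ENNReal.ofReal_le_ofReal (le_of_eq ?_)
    have : (2 * Real.pi * K i) ^ 2 ≠ 0 := by positivity
    field_simp
  have hcompl : ∫⁻ x in Uᶜ, ‖𝓕⁻ g x‖ₑ ^ 2 ≤ ENNReal.ofReal (A / 2) := by
    calc ∫⁻ x in Uᶜ, ‖𝓕⁻ g x‖ₑ ^ 2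
        ≤ ∫⁻ x in Uᶜ, ∑ i, ENNReal.ofReal ((2 * Real.pi * K i) ^ 2)⁻¹ *
            ‖𝓕⁻ (∂_{v i} g) x‖ₑ ^ 2 := by
          refine setLIntegral_mono_ae ?_ ?_
          · refine (Measurable.aemeasurable ?_)
            refine Finset.measurable_sum _ fun i _ => ?_
            exact (((𝓕⁻ (∂_{v i} g)).continuous.measurable).enorm.pow_const 2).const_mul _
          · refine Filter.Eventually.of_forall fun x hx => ?_
            -- Chebyshev: off `U` some `|⟪x, v i⟫|` exceeds `K i`, so the corresponding summand
            -- alone dominates `‖𝓕⁻ g x‖ₑ ^ 2`.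
            obtain ⟨i, hi⟩ : ∃ i, K i < |inner ℝ x (v i)| := by
              simpa [hU] using hx
            refine le_trans ?_ (Finset.single_le_sum (fun j _ => zero_le) (Finset.mem_univ i))
            have hKi := hK i
            rw [enorm_fourierInv_lineDeriv, ← mul_assoc, ← ENNReal.ofReal_mul (by positivity)]
            refine le_mul_of_one_le_left zero_le ?_
            rw [ENNReal.one_le_ofReal, inv_mul_eq_div, one_le_div (by positivity)]
            gcongr
      _ ≤ ∫⁻ x, ∑ i, ENNReal.ofReal ((2 * Real.pi * K i) ^ 2)⁻¹ *
            ‖𝓕⁻ (∂_{v i} g) x‖ₑ ^ 2 := setLIntegral_le_lintegral _ _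
      _ = ∑ i, ∫⁻ x, ENNReal.ofReal ((2 * Real.pi * K i) ^ 2)⁻¹ *
            ‖𝓕⁻ (∂_{v i} g) x‖ₑ ^ 2 := by
          refine lintegral_finsetSum _ fun i _ => ?_
          exact (((𝓕⁻ (∂_{v i} g)).continuous.measurable).enorm.pow_const 2).const_mul _
      _ ≤ ∑ i : ι, ENNReal.ofReal (A / (2 * Fintype.card ι)) := Finset.sum_le_sum fun i _ => htail i
      _ = ENNReal.ofReal (∑ i : ι, A / (2 * Fintype.card ι)) :=
          (ENNReal.ofReal_sum_of_nonneg fun i _ => by positivity).symm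
      _ ≤ ENNReal.ofReal (A / 2) := by
          refine ENNReal.ofReal_le_ofReal ?_
          rw [Finset.sum_const, Finset.card_univ, nsmul_eq_mul]
          rcases Nat.eq_zero_or_pos (Fintype.card ι) with h | h
          · simp [h]; positivity
          · have : (0 : ℝ) < Fintype.card ι := by exact_mod_cast h
            refine le_of_eq ?_
            field_simp
  have htot : ENNReal.ofReal A ≤ (∫⁻ x in U, ‖𝓕⁻ g x‖ₑ ^ 2) + ENNReal.ofReal (A / 2) := by
    refine hg.trans ?_
    rw [← lintegral_enorm_sq_fourierInv, ← lintegral_add_compl _ hUm]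
    gcongr
  have hsplit : ENNReal.ofReal A = ENNReal.ofReal (A / 2) + ENNReal.ofReal (A / 2) := by
    rw [← ENNReal.ofReal_add (by positivity) (by positivity)]; congr 1; ring
  rw [hsplit] at htot
  exact (ENNReal.add_le_add_iff_right ENNReal.ofReal_ne_top).1 htot

end Fourier

/-! ### Modulated bumps adapted to boxes -/

/-- A smooth bump on the line, equal to `1` on `[-1/2, 1/2]` and supported in `[-1, 1]`. -/
noncomputable def unitBump : ContDiffBump (0 : ℝ) := ⟨1 / 2, 1, by norm_num, by norm_num⟩

theorem exists_bound_deriv_unitBump : ∃ D : ℝ, 0 < D ∧ ∀ x, |deriv unitBump x| ≤ D := by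
  have h1 : ContDiff ℝ 1 unitBump := unitBump.contDiff
  have h2 : Continuous (deriv unitBump) := h1.continuous_deriv le_rfl
  obtain ⟨C, hC⟩ := h2.bounded_above_of_compact_support unitBump.hasCompactSupport.deriv
  exact ⟨max C 1, by positivity, fun x => (hC x).trans (le_max_left _ _)⟩

theorem unitBump_eq_one {x : ℝ} (h : |x| ≤ 1 / 2) : unitBump x = 1 :=
  unitBump.one_of_mem_closedBall (by simpa [unitBump] using h)

theorem unitBump_eq_zero {x : ℝ} (h : 1 ≤ |x|) : unitBump x = 0 :=
  unitBump.zero_of_le_dist (by simpa [unitBump] using h)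

/-- The closed box with centre `θ` and half side lengths `r`. -/
def box {d : ℕ} (θ r : Fin d → ℝ) : Set (E d) := {ω | ∀ i, |ω i - θ i| ≤ r i}

theorem isClosed_box {d : ℕ} (θ r : Fin d → ℝ) : IsClosed (box θ r) := by
  unfold box
  rw [Set.ofPred_forall]
  exact isClosed_iInter fun i => isClosed_le (by fun_prop) continuous_const

theorem volume_box {d : ℕ} (θ r : Fin d → ℝ) (hr : ∀ i, 0 ≤ r i) :
    volume (box θ r) = ENNReal.ofReal (∏ i, (2 * r i)) := by
  have h1 : box θ r = (@WithLp.ofLp 2 (Fin d → ℝ)) ⁻¹'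
      (Set.univ.pi fun i => Set.Icc (θ i - r i) (θ i + r i)) := by
    ext ω
    simp only [box, Set.mem_ofPred_eq, Set.mem_preimage, Set.mem_univ_pi, Set.mem_Icc, abs_le]
    refine forall_congr' fun i => ?_
    constructor <;> rintro ⟨h1, h2⟩ <;> constructor <;> linarith
  rw [h1, (PiLp.volume_preserving_ofLp (Fin d)).measure_preimage
    (MeasurableSet.univ_pi fun i => measurableSet_Icc).nullMeasurableSet, volume_pi_pi,
    ENNReal.ofReal_prod_of_nonneg fun i _ => by have := hr i; positivity]
  refine Finset.prod_congr rfl fun i _ => ?_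
  rw [Real.volume_Icc]
  congr 1; ring

theorem isCompact_box {d : ℕ} (θ r : Fin d → ℝ) : IsCompact (box θ r) := by
  have h1 : box θ r = (@WithLp.toLp 2 (Fin d → ℝ)) ''
      (Set.univ.pi fun i => Set.Icc (θ i - r i) (θ i + r i)) := by
    ext ω
    constructor
    · intro h
      refine ⟨fun i => ω i, fun i _ => ?_, rfl⟩
      have := abs_le.1 (h i)
      constructor <;> linarith
    · rintro ⟨y, hy, rfl⟩ i
      have := hy i (Set.mem_univ i)
      refine abs_le.2 ?_
      constructor <;> simp <;> linarith [this.1, this.2]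
  rw [h1]
  exact (isCompact_univ_pi fun i => isCompact_Icc).image (PiLp.continuous_toLp 2 _)

/-- The smooth bump adapted to the box with centre `θ` and half side lengths `r`. -/
noncomputable def tileBump {d : ℕ} (θ r : Fin d → ℝ) (ω : E d) : ℝ :=
  ∏ i, unitBump ((ω i - θ i) / r i)

theorem contDiff_tileBump {d : ℕ} (θ r : Fin d → ℝ) {m : ℕ∞} : ContDiff ℝ m (tileBump θ r) := by
  unfold tileBump
  refine contDiff_prod fun i _ => ?_
  have h : ContDiff ℝ m fun ω : E d => (ω i - θ i) / r i := by fun_prop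
  exact unitBump.contDiff.comp h

theorem tileBump_nonneg {d : ℕ} (θ r : Fin d → ℝ) (ω : E d) : 0 ≤ tileBump θ r ω :=
  Finset.prod_nonneg fun _ _ => unitBump.nonneg

theorem tileBump_le_one {d : ℕ} (θ r : Fin d → ℝ) (ω : E d) : tileBump θ r ω ≤ 1 :=
  Finset.prod_le_one (fun _ _ => unitBump.nonneg) fun _ _ => unitBump.le_one

theorem abs_sub_lt_of_tileBump_ne_zero {d : ℕ} {θ r : Fin d → ℝ} (hr : ∀ i, 0 < r i) {ω : E d}
    (h : tileBump θ r ω ≠ 0) (i : Fin d) : |ω i - θ i| < r i := by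
  by_contra! hc
  refine h (Finset.prod_eq_zero (Finset.mem_univ i) (unitBump_eq_zero ?_))
  rw [abs_div, abs_of_pos (hr i), one_le_div (hr i)]
  exact hc

theorem tileBump_eq_one {d : ℕ} {θ r : Fin d → ℝ} (hr : ∀ i, 0 < r i) {ω : E d}
    (h : ω ∈ box θ fun i => r i / 2) : tileBump θ r ω = 1 := by
  refine Finset.prod_eq_one fun i _ => unitBump_eq_one ?_
  rw [abs_div, abs_of_pos (hr i), div_le_iff₀ (hr i)]
  linarith [h i]

/-- By the product rule each term differentiates one factor, at the cost `D / r i`; the other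
factors are at most `1`. -/
theorem hasLineDerivAt_tileBump {d : ℕ} {θ r : Fin d → ℝ} (hr : ∀ i, 0 < r i) {D : ℝ}
    (hD : ∀ x, |deriv unitBump x| ≤ D) (ω v : E d) :
    ∃ b', HasLineDerivAt ℝ (tileBump θ r) b' ω v ∧ |b'| ≤ D * ∑ i, |v i| / r i := by
  have h1 : ∀ i ∈ (Finset.univ : Finset (Fin d)),
      HasDerivAt (fun s : ℝ => unitBump (((ω + s • v) i - θ i) / r i))
        (deriv unitBump ((ω i - θ i) / r i) * (v i / r i)) 0 := by
    intro i _
    have ha : HasDerivAt (fun s : ℝ => ((ω + s • v) i - θ i) / r i) (v i / r i) 0 := by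
      simp only [PiLp.add_apply, PiLp.smul_apply, smul_eq_mul]
      simpa using ((((hasDerivAt_id (0 : ℝ)).mul_const (v i)).const_add (ω i)).sub_const
        (θ i)).div_const (r i)
    have hb : HasDerivAt unitBump (deriv unitBump ((ω i - θ i) / r i))
        (((ω + (0 : ℝ) • v) i - θ i) / r i) := by
      simp only [zero_smul, add_zero]
      exact ((unitBump.contDiff (n := 1)).differentiable (by norm_num) _).hasDerivAt
    exact HasDerivAt.comp (h₂ := fun y => unitBump y)
      (h := fun s : ℝ => ((ω + s • v) i - θ i) / r i) 0 hb ha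
  refine ⟨_, HasDerivAt.fun_finsetProd h1, ?_⟩
  refine (Finset.abs_sum_le_sum_abs _ _).trans ?_
  rw [Finset.mul_sum]
  refine Finset.sum_le_sum fun i _ => ?_
  have hri := hr i
  rw [smul_eq_mul, abs_mul, abs_mul, abs_div, abs_of_pos hri]
  have h2 : |∏ j ∈ Finset.univ.erase i, unitBump (((ω + (0 : ℝ) • v) j - θ j) / r j)| ≤ 1 := by
    rw [Finset.abs_prod]
    refine Finset.prod_le_one (fun _ _ => abs_nonneg _) fun j _ => ?_
    rw [abs_of_nonneg unitBump.nonneg]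
    exact unitBump.le_one
  have hDnn : 0 ≤ D := (abs_nonneg _).trans (hD 0)
  calc _ ≤ 1 * (D * (|v i| / r i)) := by
        gcongr
        exact hD _
    _ = _ := one_mul _

/-- The modulated bump `e^{2πi L Ψ} b`, where `b` is adapted to the box `θ, r`. -/
noncomputable def wavePacket {d : ℕ} (Ψ : E d → ℝ) (L : ℝ) (θ r : Fin d → ℝ) (ω : E d) : ℂ :=
  Complex.exp (2 * Real.pi * Complex.I * ((L * Ψ ω : ℝ) : ℂ)) * (tileBump θ r ω : ℂ)

theorem norm_exp_two_pi_I_mul (x : ℝ) :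
    ‖Complex.exp (2 * Real.pi * Complex.I * (x : ℂ))‖ = 1 := by
  have : 2 * (Real.pi : ℂ) * Complex.I * (x : ℂ) = ((2 * Real.pi * x : ℝ) : ℂ) * Complex.I := by
    push_cast; ring
  rw [this, Complex.norm_exp_ofReal_mul_I]

theorem norm_wavePacket {d : ℕ} (Ψ : E d → ℝ) (L : ℝ) (θ r : Fin d → ℝ) (ω : E d) :
    ‖wavePacket Ψ L θ r ω‖ = tileBump θ r ω := by
  rw [wavePacket, norm_mul, norm_exp_two_pi_I_mul, one_mul, Complex.norm_real, Real.norm_eq_abs,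
    abs_of_nonneg (tileBump_nonneg _ _ _)]

theorem contDiff_wavePacket {d : ℕ} {Ψ : E d → ℝ} {m : ℕ∞} (hΨ : ContDiff ℝ m Ψ) (L : ℝ)
    (θ r : Fin d → ℝ) : ContDiff ℝ m (wavePacket Ψ L θ r) := by
  have h1 : ContDiff ℝ m fun ω => ((L * Ψ ω : ℝ) : ℂ) :=
    Complex.ofRealCLM.contDiff.comp (contDiff_const.mul hΨ)
  have h2 : ContDiff ℝ m fun ω => ((tileBump θ r ω : ℝ) : ℂ) :=
    Complex.ofRealCLM.contDiff.comp (contDiff_tileBump θ r)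
  exact ((contDiff_const.mul h1).cexp).mul h2

theorem tsupport_wavePacket_subset {d : ℕ} (Ψ : E d → ℝ) (L : ℝ) (θ r : Fin d → ℝ)
    (hr : ∀ i, 0 < r i) : tsupport (wavePacket Ψ L θ r) ⊆ box θ r := by
  refine closure_minimal (fun ω hω i => ?_) (isClosed_box θ r)
  have : tileBump θ r ω ≠ 0 := by
    rw [← norm_wavePacket Ψ L θ r ω]
    exact norm_ne_zero_iff.2 hω
  exact (abs_sub_lt_of_tileBump_ne_zero hr this i).le

theorem hasCompactSupport_wavePacket {d : ℕ} (Ψ : E d → ℝ) (L : ℝ) (θ r : Fin d → ℝ)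
    (hr : ∀ i, 0 < r i) : HasCompactSupport (wavePacket Ψ L θ r) :=
  (isCompact_box θ r).of_isClosed_subset (isClosed_tsupport _)
    (tsupport_wavePacket_subset Ψ L θ r hr)

theorem norm_lineDeriv_wavePacket_le {d : ℕ} {Ψ : E d → ℝ} {L : ℝ} (hL : 0 ≤ L) {θ r : Fin d → ℝ}
    (hr : ∀ i, 0 < r i) {D : ℝ} (hD : ∀ x, |deriv unitBump x| ≤ D) {M p : ℝ} (ω v : E d)
    (hp : HasLineDerivAt ℝ Ψ p ω v) (hM : |p| ≤ M) :
    ‖lineDeriv ℝ (wavePacket Ψ L θ r) ω v‖ ≤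
      2 * Real.pi * L * M + D * ∑ i, |v i| / r i := by
  obtain ⟨b', hb', hbound⟩ := hasLineDerivAt_tileBump (θ := θ) hr hD ω v
  have h1 : HasDerivAt (fun s : ℝ => 2 * Real.pi * Complex.I * ((L * Ψ (ω + s • v) : ℝ) : ℂ))
      (2 * Real.pi * Complex.I * ((L * p : ℝ) : ℂ)) 0 :=
    ((HasDerivAt.const_mul L hp).ofReal_comp).const_mul _
  have h2 : HasDerivAt (fun s : ℝ => ((tileBump θ r (ω + s • v) : ℝ) : ℂ)) (b' : ℂ) 0 :=
    HasDerivAt.ofReal_comp hb'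
  have h3 : HasLineDerivAt ℝ (wavePacket Ψ L θ r) _ ω v := h1.cexp.mul h2
  rw [h3.lineDeriv]
  simp only [zero_smul, add_zero]
  refine (norm_add_le _ _).trans ?_
  rw [norm_mul, norm_mul, norm_mul, norm_mul (Complex.exp _), norm_exp_two_pi_I_mul, one_mul, one_mul]
  simp only [norm_mul, Complex.norm_I, Complex.norm_real, Real.norm_eq_abs,
    abs_of_pos Real.pi_pos, Complex.norm_ofNat, mul_one, abs_of_nonneg hL]
  refine add_le_add ?_ hbound
  rw [abs_of_nonneg (tileBump_nonneg _ _ _)]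
  have hpi := Real.pi_pos
  calc 2 * Real.pi * (L * |p|) * tileBump θ r ω ≤ 2 * Real.pi * (L * M) * 1 := by
        have := abs_nonneg p
        have h0 : 0 ≤ M := this.trans hM
        gcongr
        · exact tileBump_nonneg _ _ _
        · exact tileBump_le_one _ _ _
    _ = _ := by ring

/-- A wave packet whose phase is almost stationary in the directions `v i` is concentrated where
the frequencies `⟪x, v i⟫` are at most `K i`. -/
theorem half_le_lintegral_fourierInv_wavePacket {d : ℕ} {Ψ : E d → ℝ} (hΨ : ContDiff ℝ ((⊤ : ℕ∞) : WithTop ℕ∞) Ψ)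
    {L : ℝ} (hL : 0 ≤ L) {θ r : Fin d → ℝ} (hr : ∀ i, 0 < r i) {D : ℝ}
    (hD : ∀ x, |deriv unitBump x| ≤ D) (v : Fin d → E d) (M K : Fin d → ℝ)
    (hK : ∀ i, 0 < K i)
    (hM : ∀ i, ∀ ω ∈ box θ r, ∃ p, HasLineDerivAt ℝ Ψ p ω (v i) ∧ |p| ≤ M i)
    (hMK : ∀ i, 2 ^ (d + 1) * (2 * Real.pi * L * M i + D * ∑ l, |v i l| / r l) ≤
      2 * Real.pi * K i) :
    ENNReal.ofReal ((∏ i, r i) / 2) ≤ ∫⁻ x in {x : E d | ∀ i, |inner ℝ x (v i)| ≤ K i},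
      ‖𝓕⁻ (wavePacket Ψ L θ r) x‖ₑ ^ 2 := by
  set g : 𝓢(E d, ℂ) := (hasCompactSupport_wavePacket Ψ L θ r hr).toSchwartzMap
    (contDiff_wavePacket hΨ L θ r) with hg
  have hgc : (g : E d → ℂ) = wavePacket Ψ L θ r := rfl
  rw [← hgc, ← SchwartzMap.fourierInv_coe]
  have hpos : 0 < ∏ i, r i := Finset.prod_pos fun i _ => hr i
  have hnn : ∀ i, 0 ≤ r i := fun i => (hr i).le
  refine half_le_lintegral_fourierInv g v K hK _ hpos.le ?_ fun i => ?_
  · have hv : volume (box θ fun i => r i / 2) = ENNReal.ofReal (∏ i, r i) := by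
      rw [volume_box _ _ fun i => by have := hnn i; positivity]
      congr 1
      exact Finset.prod_congr rfl fun i _ => by ring
    rw [← hv, ← setLIntegral_one]
    refine le_trans (setLIntegral_mono' (isClosed_box _ _).measurableSet fun ω hω => ?_)
      (setLIntegral_le_lintegral _ _)
    rw [hgc, ← ofReal_norm, norm_wavePacket, tileBump_eq_one hr hω]
    simp
  · set S : ℝ := 2 * Real.pi * L * M i + D * ∑ l, |v i l| / r l with hS
    -- The derivative is at most `S` and lives on the full box, of volume `2 ^ d * ∏ r i`.
    have hpt : ∀ ω, ‖∂_{v i} g ω‖ₑ ^ 2 ≤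
        (box θ r).indicator (fun _ => ENNReal.ofReal (S ^ 2)) ω := by
      intro ω
      by_cases hω : ω ∈ box θ r
      · rw [Set.indicator_of_mem hω, SchwartzMap.lineDerivOp_apply, hgc]
        obtain ⟨p, hp, hpM⟩ := hM i ω hω
        have := norm_lineDeriv_wavePacket_le hL (θ := θ) hr hD ω (v i) hp hpM
        rw [← ofReal_norm, ← ENNReal.ofReal_pow (norm_nonneg _)]
        exact ENNReal.ofReal_le_ofReal (pow_le_pow_left₀ (norm_nonneg _) this 2)
      · rw [Set.indicator_of_notMem hω]
        have : ∂_{v i} g ω = 0 := by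
          refine image_eq_zero_of_notMem_tsupport fun h => hω ?_
          exact tsupport_wavePacket_subset Ψ L θ r hr
            (SchwartzMap.tsupport_lineDerivOp_subset (v i) g h)
        simp [this]
    refine (lintegral_mono hpt).trans ?_
    rw [lintegral_indicator_const (isClosed_box _ _).measurableSet, volume_box _ _ hnn,
      ← ENNReal.ofReal_mul (by positivity)]
    refine ENNReal.ofReal_le_ofReal ?_
    rw [Finset.prod_mul_distrib, Finset.prod_const, Finset.card_univ, Fintype.card_fin]
    have hd : 0 < d := i.pos
    have hd' : (0 : ℝ) < d := by exact_mod_cast hd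
    have hnnS : 0 ≤ S := by
      have hDnn : 0 ≤ D := (abs_nonneg _).trans (hD 0)
      have hMnn : 0 ≤ M i := by
        obtain ⟨p, _, hp⟩ := hM i (WithLp.toLp 2 θ) fun l => by simpa using hnn l
        exact (abs_nonneg p).trans hp
      have hs : 0 ≤ ∑ l, |v i l| / r l :=
        Finset.sum_nonneg fun l _ => div_nonneg (abs_nonneg _) (hnn l)
      have := Real.pi_pos
      positivity
    -- The factor `2 ^ (d + 1)` in `hMK` pays both for the volume ratio `2 ^ d` of the two boxes and
    -- for the factor `2 d` lost in the sum over directions, since `d ≤ 2 ^ d`.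
    have h2 : (2 ^ (d + 1) * S) ^ 2 ≤ (2 * Real.pi * K i) ^ 2 :=
      pow_le_pow_left₀ (by positivity) (hMK i) 2
    have h3 : (d : ℝ) ≤ 2 ^ d := by exact_mod_cast Nat.lt_two_pow_self.le
    have h4 : (2 ^ (d + 1) * S) ^ 2 = S ^ 2 * 2 ^ d * (4 * 2 ^ d) := by ring
    rw [h4] at h2
    have h5 : S ^ 2 * 2 ^ d * (2 * d) ≤ (2 * Real.pi * K i) ^ 2 := by
      refine le_trans ?_ h2
      gcongr
      norm_num
    calc S ^ 2 * (2 ^ d * ∏ i, r i) = S ^ 2 * 2 ^ d * (2 * d) * ((∏ i, r i) / (2 * d)) := by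
          field_simp
      _ ≤ _ := by
          gcongr

/-! ### Pairs of coordinates and the phases of the wave packets -/

/-- The other index of the pair `{2m, 2m + 1}` (an unpaired last index is its own partner). -/
def partner {d : ℕ} (i : Fin d) : Fin d :=
  if Odd (i : ℕ) then ⟨i - 1, by omega⟩ else if h : (i : ℕ) + 1 < d then ⟨i + 1, h⟩ else i

theorem partner_involutive {d : ℕ} : Function.Involutive (partner : Fin d → Fin d) := by
  intro i
  unfold partner
  rcases Nat.even_or_odd (i : ℕ) with ⟨m, hm⟩ | ⟨m, hm⟩
  · have h1 : ¬ Odd (i : ℕ) := by rw [Nat.not_odd_iff_even]; exact ⟨m, hm⟩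
    by_cases h2 : (i : ℕ) + 1 < d
    · have h3 : Odd ((i : ℕ) + 1) := ⟨m, by omega⟩
      simp [h1, h2, h3]
    · simp [h1, h2]
  · have h1 : Odd (i : ℕ) := ⟨m, hm⟩
    have h2 : ¬ Odd ((i : ℕ) - 1) := by rw [Nat.not_odd_iff_even]; exact ⟨m, by omega⟩
    have h3 : (i : ℕ) - 1 + 1 = i := by omega
    simp [h1, h2, h3]

theorem partner_of_odd {d : ℕ} {i : Fin d} (h : Odd (i : ℕ)) : ((partner i : Fin d) : ℕ) = i - 1 := by
  simp [partner, h]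

theorem partner_lt_iff {d k : ℕ} (i : Fin d) :
    ((partner i : Fin d) : ℕ) < 2 * k ↔ (i : ℕ) < 2 * k := by
  unfold partner
  have := i.2
  rcases Nat.even_or_odd (i : ℕ) with ⟨m, hm⟩ | ⟨m, hm⟩
  · have h1 : ¬ Odd (i : ℕ) := by rw [Nat.not_odd_iff_even]; exact ⟨m, hm⟩
    by_cases h2 : (i : ℕ) + 1 < d
    · simp only [h1, h2, if_false, dif_pos]; omega
    · simp [h1, h2]
  · have h1 : Odd (i : ℕ) := ⟨m, hm⟩
    simp only [h1, if_true]; omega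

/-- The phase of the input wave packet centred at `θ`. -/
noncomputable def pairPhase {d : ℕ} (k : ℕ) (θ : Fin d → ℝ) (ω : E d) : ℝ :=
  ∑ l : Fin d, if (l : ℕ) < 2 * k then -(1 / 2) * (ω l * ω (partner l))
    else profileRate l * θ (partner l) * ω l

/-- The phase of the wave packet centred at `θ` at time `τ`. -/
noncomputable def tilePhase {d : ℕ} (k : ℕ) (τ : ℝ) (θ : Fin d → ℝ) (ω : E d) : ℝ :=
  (1 / 2) * ∑ l : Fin d, profile k l τ * ω l ^ 2 - pairPhase k θ ω

/-- The `l`-th partial derivative of `tilePhase`. -/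
noncomputable def slope {d : ℕ} (k : ℕ) (τ : ℝ) (θ : Fin d → ℝ) (ω : E d) (l : Fin d) : ℝ :=
  profile k l τ * ω l +
    if (l : ℕ) < 2 * k then ω (partner l) else -(profileRate l * θ (partner l))

theorem contDiff_pairPhase {d : ℕ} (k : ℕ) (θ : Fin d → ℝ) {m : WithTop ℕ∞} :
    ContDiff ℝ m (pairPhase k θ) := by
  unfold pairPhase
  refine ContDiff.sum fun l _ => ?_
  split_ifs <;> fun_prop

theorem contDiff_tilePhase {d : ℕ} (k : ℕ) (τ : ℝ) (θ : Fin d → ℝ) {m : WithTop ℕ∞} :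
    ContDiff ℝ m (tilePhase k τ θ) := by
  have := contDiff_pairPhase k θ (m := m)
  unfold tilePhase
  fun_prop

theorem hasLineDerivAt_tilePhase {d k : ℕ} (τ : ℝ) (θ : Fin d → ℝ) (ω v : E d) :
    HasLineDerivAt ℝ (tilePhase k τ θ) (∑ l, v l * slope k τ θ ω l) ω v := by
  have hc : ∀ l : Fin d, HasDerivAt (fun s : ℝ => (ω + s • v) l) (v l) 0 := by
    intro l
    simp only [PiLp.add_apply, PiLp.smul_apply, smul_eq_mul]
    simpa using ((hasDerivAt_id (0 : ℝ)).mul_const (v l)).const_add (ω l)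
  have h1 : ∀ l ∈ (Finset.univ : Finset (Fin d)),
      HasDerivAt (fun s : ℝ => profile k l τ * (ω + s • v) l ^ 2)
        (2 * (v l * (profile k l τ * ω l))) 0 := by
    intro l _
    refine (((hc l).pow 2).const_mul _).congr_deriv ?_
    simp; ring
  have h2 : ∀ l ∈ (Finset.univ : Finset (Fin d)), HasDerivAt (fun s : ℝ =>
      if (l : ℕ) < 2 * k then -(1 / 2) * ((ω + s • v) l * (ω + s • v) (partner l))
        else profileRate l * θ (partner l) * (ω + s • v) l)
      (if (l : ℕ) < 2 * k then -(1 / 2) * (v l * ω (partner l)) - (1 / 2) * (ω l * v (partner l))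
        else profileRate l * θ (partner l) * v l) 0 := by
    intro l _
    split_ifs
    · refine (((hc l).mul (hc (partner l))).const_mul _).congr_deriv ?_
      simp; ring
    · exact (hc l).const_mul _
  have h3 : HasLineDerivAt ℝ (tilePhase k τ θ) _ ω v :=
    ((HasDerivAt.fun_sum h1).const_mul (1 / 2)).sub (HasDerivAt.fun_sum h2)
  refine HasDerivAt.congr_deriv h3 ?_
  -- Each product `ω l * ω (partner l)` occurs for both members of its pair; reindexing by the
  -- involution merges the two halves of the product rule.
  have h4 : ∑ l : Fin d, (if (l : ℕ) < 2 * k then (1 / 2) * (ω l * v (partner l)) else 0) =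
      ∑ l : Fin d, if (l : ℕ) < 2 * k then (1 / 2) * (v l * ω (partner l)) else 0 := by
    refine Fintype.sum_equiv partner_involutive.toPerm _ _ fun l => ?_
    simp only [Function.Involutive.coe_toPerm, partner_lt_iff, partner_involutive l]
    split_ifs <;> ring
  have h5 : ∑ l : Fin d, (if (l : ℕ) < 2 * k then
        -(1 / 2) * (v l * ω (partner l)) - (1 / 2) * (ω l * v (partner l))
        else profileRate l * θ (partner l) * v l) =
      (∑ l : Fin d, if (l : ℕ) < 2 * k then -(1 / 2) * (v l * ω (partner l))
        else profileRate l * θ (partner l) * v l) -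
      ∑ l : Fin d, if (l : ℕ) < 2 * k then (1 / 2) * (ω l * v (partner l)) else 0 := by
    rw [← Finset.sum_sub_distrib]
    refine Finset.sum_congr rfl fun l _ => ?_
    split_ifs <;> ring
  rw [h5, h4, Finset.mul_sum, ← Finset.sum_sub_distrib, ← Finset.sum_sub_distrib]
  refine Finset.sum_congr rfl fun l _ => ?_
  unfold slope
  split_ifs <;> ring

/-- The direction in which the `i`-th frequency of the wave packets is measured at time `τ`. -/
noncomputable def dirVec {d : ℕ} (τ : ℝ) (i : Fin d) : E d :=
  EuclideanSpace.single i 1 -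
    (if Odd (i : ℕ) then Real.exp (-τ) else 0) • EuclideanSpace.single (partner i) 1

theorem dirVec_apply {d : ℕ} (τ : ℝ) (i l : Fin d) : dirVec τ i l =
    (if l = i then 1 else 0) -
      (if Odd (i : ℕ) then Real.exp (-τ) else 0) * if l = partner i then 1 else 0 := by
  by_cases h : Odd (i : ℕ) <;> simp [dirVec, PiLp.single_apply, h]

theorem sum_dirVec_mul {d : ℕ} (τ : ℝ) (i : Fin d) (f : Fin d → ℝ) :
    ∑ l, dirVec τ i l * f l =
      f i - (if Odd (i : ℕ) then Real.exp (-τ) else 0) * f (partner i) := by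
  simp [dirVec_apply, sub_mul, Finset.sum_sub_distrib]

theorem inner_dirVec {d : ℕ} (τ : ℝ) (i : Fin d) (x : E d) : inner ℝ x (dirVec τ i) =
    x i - (if Odd (i : ℕ) then Real.exp (-τ) else 0) * x (partner i) := by
  rw [PiLp.inner_apply, ← sum_dirVec_mul τ i fun l => x l]
  simp

theorem sum_abs_dirVec_div_le {d : ℕ} {τ : ℝ} (hτ : 0 ≤ τ) (i : Fin d) {r : Fin d → ℝ}
    (hr : ∀ l, 0 < r l) (hp : r (partner i) = r i) :
    ∑ l, |dirVec τ i l| / r l ≤ 2 / r i := by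
  set c : ℝ := if Odd (i : ℕ) then Real.exp (-τ) else 0 with hc
  have hc0 : 0 ≤ c := by rw [hc]; split_ifs <;> positivity
  have hc1 : c ≤ 1 := by
    rw [hc]; split_ifs
    · exact Real.exp_le_one_iff.2 (by linarith)
    · exact zero_le_one
  calc ∑ l, |dirVec τ i l| / r l
      ≤ ∑ l, ((if l = i then 1 else 0) / r l + c * (if l = partner i then 1 else 0) / r l) := by
        refine Finset.sum_le_sum fun l _ => ?_
        rw [← add_div, dirVec_apply]
        have := hr l
        gcongr
        refine (abs_sub _ _).trans (le_of_eq ?_)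
        rw [abs_mul, abs_of_nonneg hc0]
        congr 1
        · split_ifs <;> simp
        · split_ifs <;> simp
    _ = 1 / r i + c / r (partner i) := by
        simp [Finset.sum_add_distrib, ite_div, mul_ite]
    _ ≤ 2 / r i := by
        rw [hp, ← add_div]
        have := hr i
        gcongr
        linarith

theorem abs_profile_le {k i : ℕ} {τ : ℝ} (h0 : 0 ≤ τ) (h1 : τ ≤ 1) : |profile k i τ| ≤ 3 := by
  have h := profileRate_mul_profile_abs k i τ
  rw [abs_mul, profileRate_abs, one_mul] at h
  rw [h]
  have h2 : profileRate i * τ ≤ 1 := by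
    unfold profileRate; split_ifs <;> linarith
  exact (Real.exp_le_exp.2 h2).trans (by linarith [Real.exp_one_lt_d9])

/-- A crude bound, used for even indices: there the strip has the full length `κ N²`, and it is
enough to take `c` small. -/
theorem abs_slope_le {d k : ℕ} {τ : ℝ} (h0 : 0 ≤ τ) (h1 : τ ≤ 1)
    {c : ℝ} {θ r : Fin d → ℝ} (hθ : ∀ l, |θ l| ≤ 2 * c) (hr : ∀ l, r l ≤ c) {ω : E d}
    (hω : ω ∈ box θ r) (l : Fin d) : |slope k τ θ ω l| ≤ 12 * c := by
  have hb : ∀ l, |ω l| ≤ 3 * c := fun l => by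
    have h2 := hω l
    have h3 := hθ l
    have h4 := hr l
    have h5 := abs_sub_abs_le_abs_sub (ω l) (θ l)
    linarith
  unfold slope
  refine (abs_add_le _ _).trans ?_
  have h2 : |profile k l τ * ω l| ≤ 3 * (3 * c) := by
    rw [abs_mul]
    have := abs_profile_le (k := k) (i := l) h0 h1
    have := hb l
    gcongr
  have h3 : |if (l : ℕ) < 2 * k then ω (partner l) else -(profileRate l * θ (partner l))| ≤
      3 * c := by
    split_ifs
    · exact hb _
    · rw [abs_neg, abs_mul, profileRate_abs, one_mul]
      have := hθ (partner l)
      linarith [abs_nonneg (θ (partner l))]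
  linarith

/-- The focusing mechanism. In the first `k` pairs the gradient of a rank-one form is parallel to a
fixed direction, so the combination vanishes identically. In the others the linear phase cancels
everything except the deviation from the centre of the tile, which is of the order of the tile side.
The direction depends on `τ` but not on `θ`, so it is common to all tiles. -/
theorem slope_combination_of_odd {d k : ℕ} (τ : ℝ) (θ : Fin d → ℝ) (ω : E d)
    {i : Fin d} (hi : Odd (i : ℕ)) :
    slope k τ θ ω i - Real.exp (-τ) * slope k τ θ ω (partner i) =
      if (i : ℕ) < 2 * k then 0 else
        -(Real.exp (-τ) * (ω i - θ i)) - (ω (partner i) - θ (partner i)) := by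
  have he : Even ((partner i : Fin d) : ℕ) := by
    rw [partner_of_odd hi]
    obtain ⟨m, hm⟩ := hi
    exact ⟨m, by omega⟩
  have hexp : Real.exp (-τ) * Real.exp τ = 1 := by rw [← Real.exp_add]; simp
  have hi' := Nat.not_even_iff_odd.2 hi
  have he' := Nat.not_odd_iff_even.2 he
  unfold slope profile profileSign profileRate
  simp only [partner_lt_iff, partner_involutive i, hi, hi', he, he']
  by_cases h : (i : ℕ) < 2 * k
  · have h2 : ¬ 2 * k ≤ (i : ℕ) := not_le.2 h
    simp only [h, h2, if_true, if_false, and_false, false_and, one_mul, neg_mul]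
    linear_combination (-ω (partner i)) * hexp
  · have h2 : 2 * k ≤ (i : ℕ) := not_lt.1 h
    simp only [h, h2, if_true, if_false, and_self, false_and, one_mul, neg_mul]
    linear_combination (-ω (partner i)) * hexp

/-! ### Tiles and the common slab -/

/-- The number of tiles in the `l`-th coordinate. -/
def tileCount (k N l : ℕ) : ℕ := if l < 2 * k then 1 else N

/-- The side lengths of the tiles. -/
noncomputable def tileRadius {d : ℕ} (c : ℝ) (k N : ℕ) (l : Fin d) : ℝ := c / tileCount k N l

/-- The centre of the tile with index `j`. -/
noncomputable def tileCenter {d : ℕ} (c : ℝ) (k N : ℕ) (j : Fin d → ℕ) (l : Fin d) : ℝ :=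
  2 * c * j l / tileCount k N l

/-- The size, in the directions `dirVec`, of the set on which the wave packets concentrate. -/
noncomputable def slabWidth (κ K : ℝ) (k N i : ℕ) : ℝ :=
  if Even i then κ * N ^ 2 else if i < 2 * k then K else K * N

theorem tileCount_pos {k N : ℕ} (hN : 1 ≤ N) (l : ℕ) : 1 ≤ tileCount k N l := by
  unfold tileCount; split_ifs <;> omega

theorem tileCount_le {k N : ℕ} (hN : 1 ≤ N) (l : ℕ) : tileCount k N l ≤ N := by
  unfold tileCount; split_ifs <;> omega

theorem tileRadius_pos {d k N : ℕ} {c : ℝ} (hc : 0 < c) (hN : 1 ≤ N) (l : Fin d) :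
    0 < tileRadius c k N l :=
  div_pos hc (by exact_mod_cast tileCount_pos hN l)

theorem tileRadius_le {d k N : ℕ} {c : ℝ} (hc : 0 < c) (hN : 1 ≤ N) (l : Fin d) :
    tileRadius c k N l ≤ c :=
  div_le_self hc.le (by exact_mod_cast tileCount_pos hN l)

theorem abs_tileCenter_le {d k N : ℕ} {c : ℝ} (hc : 0 < c) (hN : 1 ≤ N) {j : Fin d → ℕ}
    (hj : ∀ l : Fin d, j l < tileCount k N l) (l : Fin d) : |tileCenter c k N j l| ≤ 2 * c := by
  have h1 : (0 : ℝ) < tileCount k N l := by exact_mod_cast tileCount_pos hN l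
  have h2 : (j l : ℝ) ≤ tileCount k N l := by exact_mod_cast (hj l).le
  unfold tileCenter
  rw [abs_of_nonneg (by positivity), div_le_iff₀ h1]
  gcongr

/-- Each wave packet has at least half of its `L²` mass, at each time `τ`, in a slab which does
not depend on the wave packet. -/
theorem exists_half_le_lintegral_fourierInv_tile (d k : ℕ) {κ : ℝ} (hκ : 0 < κ) :
    ∃ c K : ℝ, ∃ N₀ : ℕ, 0 < c ∧ c ≤ 1 / (6 * (d + 1)) ∧ 0 < K ∧ ∀ N : ℕ, N₀ ≤ N → 1 ≤ N →
      ∀ j : Fin d → ℕ, (∀ l : Fin d, j l < tileCount k N l) → ∀ τ : ℝ, 0 ≤ τ → τ ≤ 1 →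
        ENNReal.ofReal ((∏ i : Fin d, tileRadius c k N i) / 2) ≤
          ∫⁻ x in {x : E d | ∀ i, |inner ℝ x (dirVec τ i)| ≤ slabWidth κ K k N i},
            ‖𝓕⁻ (wavePacket (tilePhase k τ (tileCenter c k N j)) (N ^ 2) (tileCenter c k N j)
              (tileRadius c k N)) x‖ₑ ^ 2 := by
  obtain ⟨D, hD0, hD⟩ := exists_bound_deriv_unitBump
  set W : ℝ := 2 ^ (d + 1) with hW
  have hW0 : 0 < W := by positivity
  have hpi : 1 < Real.pi := by linarith [Real.pi_gt_three]
  -- The first bound keeps all tiles in the ball of radius `1/2`, where the cutoff is `1`; the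
  -- second makes the slopes, at most `12 * c`, fit into the width `κ * N ^ 2`.
  set c : ℝ := min (1 / (6 * (d + 1))) (κ / (24 * W)) with hc
  have hc0 : 0 < c := lt_min (by positivity) (by positivity)
  have hcκ : 24 * W * c ≤ κ := by
    have : c ≤ κ / (24 * W) := min_le_right _ _
    rw [le_div_iff₀ (by positivity)] at this
    linarith
  -- The term `2 * c` absorbs the slope `2 * c / N` on a tile, and `D / c` absorbs the derivative of
  -- the bump.
  set K : ℝ := W * (2 * c + D / c) with hK
  have hK0 : 0 < K := by positivity
  -- For even indices the derivative of the bump is of order `N`, and is dominated by `κ * N ^ 2`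
  -- once `N` is large.
  obtain ⟨N₀, hN₀⟩ := exists_nat_ge (2 * W * D / (c * κ))
  refine ⟨c, K, N₀, hc0, min_le_left _ _, hK0, fun N hN hN1 j hj τ h0 h1 => ?_⟩
  have hN1' : (1 : ℝ) ≤ N := by exact_mod_cast hN1
  have hNbig : 2 * W * D / c ≤ κ * N := by
    have h2 : 2 * W * D / (c * κ) ≤ N := hN₀.trans (by exact_mod_cast hN)
    rw [div_le_iff₀ (by positivity)] at h2 ⊢
    linarith
  have hrpos : ∀ l : Fin d, 0 < tileRadius c k N l := tileRadius_pos hc0 hN1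
  have hrp : ∀ l : Fin d, tileRadius c k N (partner l) = tileRadius c k N l := fun l => by
    simp only [tileRadius, tileCount, partner_lt_iff]
  refine half_le_lintegral_fourierInv_wavePacket (contDiff_tilePhase k τ _) (by positivity)
    hrpos hD (dirVec τ)
    (fun i => if Even (i : ℕ) then 12 * c else if (i : ℕ) < 2 * k then 0 else 2 * c / N)
    (fun i => slabWidth κ K k N i) ?_ ?_ ?_
  · intro i
    unfold slabWidth
    split_ifs <;> positivity
  · intro i ω hω
    refine ⟨_, hasLineDerivAt_tilePhase τ _ ω _, ?_⟩
    rw [sum_dirVec_mul]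
    rcases Nat.even_or_odd (i : ℕ) with he | ho
    · have hno := Nat.not_odd_iff_even.2 he
      simp only [he, hno, if_true, if_false, zero_mul, sub_zero]
      exact abs_slope_le h0 h1 (abs_tileCenter_le hc0 hN1 hj) (tileRadius_le hc0 hN1) hω i
    · have hne := Nat.not_even_iff_odd.2 ho
      simp only [ho, hne, if_true, if_false]
      rw [slope_combination_of_odd τ _ ω ho]
      split_ifs with hlt
      · simp
      · have h2 := hω i
        have h3 := hω (partner i)
        rw [hrp i] at h3
        have h4 : tileRadius c k N i = c / N := by simp [tileRadius, tileCount, hlt]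
        rw [h4] at h2 h3
        refine (abs_sub _ _).trans ?_
        rw [abs_neg, abs_mul, abs_of_pos (Real.exp_pos _)]
        have h5 : Real.exp (-τ) ≤ 1 := Real.exp_le_one_iff.2 (by linarith)
        have h6 : Real.exp (-τ) * |ω i - tileCenter c k N j i| ≤ 1 * (c / N) := by gcongr
        have h7 : 2 * c / (N : ℝ) = c / N + c / N := by ring
        linarith
  · intro i
    have hs := sum_abs_dirVec_div_le h0 i hrpos (hrp i)
    have hs' : D * ∑ l, |dirVec τ i l| / tileRadius c k N l ≤ D * (2 / tileRadius c k N i) := by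
      gcongr
    have hNc : (0 : ℝ) < tileCount k N i := by exact_mod_cast tileCount_pos hN1 i
    have h2 : 2 / tileRadius c k N i = 2 * tileCount k N i / c := by
      unfold tileRadius; field_simp
    rw [h2] at hs'
    unfold slabWidth
    rcases Nat.even_or_odd (i : ℕ) with he | ho
    · simp only [he, if_true]
      have h3 : (tileCount k N i : ℝ) ≤ N := by exact_mod_cast tileCount_le hN1 i
      have h4 : D * (2 * tileCount k N i / c) ≤ D * (2 * N / c) := by gcongr
      have h5 : W * (D * (2 * N / c)) ≤ κ * N ^ 2 := by
        calc W * (D * (2 * N / c)) = (2 * W * D / c) * N := by ring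
          _ ≤ (κ * N) * N := by gcongr
          _ = κ * N ^ 2 := by ring
      have h6 : W * (2 * Real.pi * N ^ 2 * (12 * c)) ≤ Real.pi * (κ * N ^ 2) := by
        calc W * (2 * Real.pi * N ^ 2 * (12 * c)) = (24 * W * c) * (Real.pi * N ^ 2) := by ring
          _ ≤ κ * (Real.pi * N ^ 2) := by gcongr
          _ = _ := by ring
      have h7 : κ * N ^ 2 ≤ Real.pi * (κ * N ^ 2) := le_mul_of_one_le_left (by positivity) hpi.le
      have h8 := mul_le_mul_of_nonneg_left (hs'.trans h4) hW0.le
      rw [mul_add]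
      linarith
    · have hne := Nat.not_even_iff_odd.2 ho
      simp only [hne, if_false]
      have hKp : K ≤ Real.pi * K := le_mul_of_one_le_left hK0.le hpi.le
      split_ifs with hlt
      · have h3 : (tileCount k N i : ℝ) = 1 := by simp [tileCount, hlt]
        rw [h3] at hs'
        have h8 := mul_le_mul_of_nonneg_left hs' hW0.le
        have h9 : W * (D * (2 * 1 / c)) ≤ 2 * K := by
          rw [hK]
          have : W * (D * (2 * 1 / c)) = 2 * (W * (D / c)) := by ring
          rw [this]
          gcongr
          linarith
        rw [mul_zero, zero_add]
        linarith
      · have h3 : (tileCount k N i : ℝ) = N := by simp [tileCount, hlt]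
        rw [h3] at hs'
        have h8 := mul_le_mul_of_nonneg_left hs' hW0.le
        have h9 : W * (D * (2 * N / c)) ≤ Real.pi * (2 * N * (W * (D / c))) := by
          have : W * (D * (2 * N / c)) = 2 * N * (W * (D / c)) := by ring
          rw [this]
          exact le_mul_of_one_le_left (by positivity) hpi.le
        have h10 : W * (2 * Real.pi * N ^ 2 * (2 * c / N)) = Real.pi * (2 * N * (W * (2 * c))) := by
          field_simp
        rw [mul_add, h10]
        have h11 : 2 * Real.pi * (K * N) =
            Real.pi * (2 * N * (W * (2 * c))) + Real.pi * (2 * N * (W * (D / c))) := by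
          rw [hK]; ring
        linarith

/-! ### Geometry of the slab in space-time -/

/-- The point `(t, y)` of `ℝ^(d+1) = ℝ × ℝ^d`. -/
noncomputable def join {d : ℕ} (t : ℝ) (y : E d) : E (d + 1) :=
  WithLp.toLp 2 (Fin.cons t fun i => y i : Fin (d + 1) → ℝ)

@[simp] theorem join_zero {d : ℕ} (t : ℝ) (y : E d) : join t y 0 = t := rfl

@[simp] theorem join_succ {d : ℕ} (t : ℝ) (y : E d) (i : Fin d) : join t y i.succ = y i := rfl

/-- Tonelli's theorem in the splitting of space-time into time and space, which allows each time to
be treated by the Fourier transform. -/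
theorem lintegral_eq_lintegral_join {d : ℕ} {H : E (d + 1) → ℝ≥0∞} (hH : Measurable H) :
    ∫⁻ x, H x = ∫⁻ t : ℝ, ∫⁻ y : E d, H (join t y) := by
  have hm : Measurable fun z : Fin (d + 1) → ℝ => H (WithLp.toLp 2 z) :=
    hH.comp (PiLp.continuous_toLp 2 _).measurable
  rw [← (PiLp.volume_preserving_toLp (Fin (d + 1))).lintegral_comp hH,
    ← ((volume_preserving_piFinSuccAbove (fun _ : Fin (d + 1) => ℝ) 0).symm _).lintegral_comp hm,
    Measure.volume_eq_prod, lintegral_prod (fun a : ℝ × (Fin d → ℝ) => H (WithLp.toLp 2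
      ((MeasurableEquiv.piFinSuccAbove (fun _ : Fin (d + 1) => ℝ) 0).symm a)))
      (hm.comp (MeasurableEquiv.measurable _)).aemeasurable]
  refine lintegral_congr fun t => ?_
  have hj : Measurable fun y : E d => H (join t y) := by
    refine hH.comp ((PiLp.continuous_toLp 2 _).comp (continuous_pi fun l => ?_)).measurable
    refine Fin.cases ?_ (fun i => ?_) l
    · exact continuous_const
    · simp only [Fin.cons_succ]; fun_prop
  rw [← (PiLp.volume_preserving_toLp (Fin d)).lintegral_comp hj]
  refine lintegral_congr fun y => ?_
  congr 2
  ext l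
  refine Fin.cases ?_ (fun i => ?_) l
  · simp [MeasurableEquiv.piFinSuccAbove, Fin.insertNthEquiv]
  · simp [MeasurableEquiv.piFinSuccAbove, Fin.insertNthEquiv]

theorem norm_le_sum_abs {m : ℕ} (x : E m) : ‖x‖ ≤ ∑ i, |x i| := by
  have h := (EuclideanSpace.basisFun (Fin m) ℝ).sum_repr x
  calc ‖x‖ = ‖∑ i, (EuclideanSpace.basisFun (Fin m) ℝ).repr x i •
        EuclideanSpace.basisFun (Fin m) ℝ i‖ := by rw [h]
    _ ≤ _ := norm_sum_le _ _
    _ = ∑ i, |x i| := by simp [norm_smul]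

theorem cutoff_eq_one {m : ℕ} {x : E m} (h : ‖x‖ ≤ 1 / 2) : cutoff m x = 1 :=
  (cutoff m).one_of_mem_closedBall (by simpa [cutoff] using h)

/-- The set at time `τ` on which the wave packets concentrate. -/
def slice (d : ℕ) (κ K : ℝ) (k N : ℕ) (τ : ℝ) : Set (E d) :=
  {y | ∀ i, |inner ℝ y (dirVec τ i)| ≤ slabWidth κ K k N i}

/-- The set in space-time on which the wave packets concentrate. -/
def slab (d : ℕ) (κ K : ℝ) (k N : ℕ) : Set (E (d + 1)) :=
  {x | x 0 ∈ Set.Icc 0 ((N : ℝ) ^ 2 / 4) ∧ ∀ i : Fin d,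
    |x i.succ - (if Odd (i : ℕ) then Real.exp (-(((N : ℝ) ^ 2)⁻¹ * x 0)) else 0) *
      x (partner i).succ| ≤ slabWidth κ K k N i}

theorem join_mem_slab {d : ℕ} {κ K : ℝ} {k N : ℕ} {t : ℝ} {y : E d} :
    join t y ∈ slab d κ K k N ↔ t ∈ Set.Icc 0 ((N : ℝ) ^ 2 / 4) ∧
      y ∈ slice d κ K k N (((N : ℝ) ^ 2)⁻¹ * t) := by
  simp [slab, slice, inner_dirVec]

theorem measurableSet_slab (d : ℕ) (κ K : ℝ) (k N : ℕ) : MeasurableSet (slab d κ K k N) := by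
  refine IsClosed.measurableSet ?_
  unfold slab
  have h : IsClosed {x : E (d + 1) | ∀ i : Fin d,
      |x i.succ - (if Odd (i : ℕ) then Real.exp (-(((N : ℝ) ^ 2)⁻¹ * x 0)) else 0) *
        x (partner i).succ| ≤ slabWidth κ K k N i} := by
    rw [Set.ofPred_forall]
    refine isClosed_iInter fun i => isClosed_le ?_ continuous_const
    split_ifs <;> fun_prop
  exact IsClosed.inter (isClosed_Icc.preimage (by fun_prop)) h

theorem isClosed_slice (d : ℕ) (κ K : ℝ) (k N : ℕ) (τ : ℝ) : IsClosed (slice d κ K k N τ) := by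
  unfold slice
  rw [Set.ofPred_forall]
  exact isClosed_iInter fun i => isClosed_le (by fun_prop) continuous_const

theorem slabWidth_nonneg {κ K : ℝ} (hκ : 0 ≤ κ) (hK : 0 ≤ K) (k N i : ℕ) :
    0 ≤ slabWidth κ K k N i := by
  unfold slabWidth; split_ifs <;> positivity

/-- The partner of an odd index is the preceding index, so the matrix is lower triangular with unit
diagonal. The slices therefore have the volume of a product of intervals, whatever the time. -/
theorem det_dirVec (d : ℕ) (τ : ℝ) :
    (Matrix.of fun i l : Fin d => dirVec τ i l).det = 1 := by
  have hne : ∀ i : Fin d, Odd (i : ℕ) → ((partner i : Fin d) : ℕ) < i := fun i hi => by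
    rw [partner_of_odd hi]
    obtain ⟨m, hm⟩ := hi
    omega
  rw [Matrix.det_of_isLowerTriangular]
  · refine Finset.prod_eq_one fun i _ => ?_
    rw [Matrix.of_apply, dirVec_apply]
    by_cases hi : Odd (i : ℕ)
    · have h1 : i ≠ partner i := fun h => by
        have := hne i hi
        rw [← h] at this
        exact lt_irrefl _ this
      simp [h1]
    · simp [hi]
  · intro i l hil
    have hlt : i < l := hil
    rw [Matrix.of_apply, dirVec_apply, if_neg hlt.ne']
    by_cases hi : Odd (i : ℕ)
    · have h1 : l ≠ partner i := fun h => by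
        have h2 := hne i hi
        rw [← h] at h2
        exact absurd h2 (not_lt.2 hlt.le)
      simp [h1]
    · simp [hi]

theorem volume_slice (d : ℕ) {κ K : ℝ} (hκ : 0 ≤ κ) (hK : 0 ≤ K) (k N : ℕ) (τ : ℝ) :
    volume (slice d κ K k N τ) = ENNReal.ofReal (∏ i : Fin d, (2 * slabWidth κ K k N i)) := by
  set M : Matrix (Fin d) (Fin d) ℝ := Matrix.of fun i l : Fin d => dirVec τ i l with hM
  have hS : MeasurableSet (Set.univ.pi fun i : Fin d =>
      Set.Icc (-slabWidth κ K k N i) (slabWidth κ K k N i)) :=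
    MeasurableSet.univ_pi fun i => measurableSet_Icc
  have h1 : slice d κ K k N τ = (@WithLp.ofLp 2 (Fin d → ℝ)) ⁻¹' (Matrix.toLin' M ⁻¹'
      (Set.univ.pi fun i : Fin d => Set.Icc (-slabWidth κ K k N i) (slabWidth κ K k N i))) := by
    ext y
    simp only [slice, Set.mem_ofPred_eq, Set.mem_preimage, Set.mem_univ_pi, Set.mem_Icc, abs_le]
    refine forall_congr' fun i => ?_
    have : Matrix.toLin' M (WithLp.ofLp y) i = inner ℝ y (dirVec τ i) := by
      rw [Matrix.toLin'_apply, Matrix.mulVec, PiLp.inner_apply]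
      exact Finset.sum_congr rfl fun l _ => by simp [hM]
    rw [this]
  have hdet : LinearMap.det (Matrix.toLin' M) = 1 := by
    rw [LinearMap.det_toLin', hM, det_dirVec]
  have hmeas : MeasurableSet (Matrix.toLin' M ⁻¹' (Set.univ.pi fun i : Fin d =>
      Set.Icc (-slabWidth κ K k N i) (slabWidth κ K k N i))) :=
    (LinearMap.continuous_of_finiteDimensional (Matrix.toLin' M)).measurable hS
  rw [h1, (PiLp.volume_preserving_ofLp (Fin d)).measure_preimage hmeas.nullMeasurableSet,
    Measure.addHaar_preimage_linearMap _ (by rw [hdet]; exact one_ne_zero), hdet, volume_pi_pi,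
    ENNReal.ofReal_prod_of_nonneg fun i _ => by
      have := slabWidth_nonneg hκ hK k N i; positivity]
  simp only [inv_one, abs_one, ENNReal.ofReal_one, one_mul, Real.volume_Icc]
  refine Finset.prod_congr rfl fun i _ => ?_
  congr 1; ring

theorem volume_slab (d : ℕ) {κ K : ℝ} (hκ : 0 ≤ κ) (hK : 0 ≤ K) (k N : ℕ) :
    volume (slab d κ K k N) =
      ENNReal.ofReal (∏ i : Fin d, (2 * slabWidth κ K k N i)) *
        ENNReal.ofReal ((N : ℝ) ^ 2 / 4) := by
  have hm := measurableSet_slab d κ K k N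
  rw [← lintegral_indicator_one hm, lintegral_eq_lintegral_join (measurable_one.indicator hm)]
  have h1 : ∀ t : ℝ, ∫⁻ y : E d, (slab d κ K k N).indicator 1 (join t y) =
      (Set.Icc 0 ((N : ℝ) ^ 2 / 4)).indicator (fun _ =>
        ENNReal.ofReal (∏ i : Fin d, (2 * slabWidth κ K k N i))) t := by
    intro t
    by_cases ht : t ∈ Set.Icc 0 ((N : ℝ) ^ 2 / 4)
    · rw [Set.indicator_of_mem ht, ← volume_slice d hκ hK k N (((N : ℝ) ^ 2)⁻¹ * t),
        ← lintegral_indicator_one (isClosed_slice d κ K k N _).measurableSet]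
      refine lintegral_congr fun y => ?_
      by_cases hy : y ∈ slice d κ K k N (((N : ℝ) ^ 2)⁻¹ * t)
      · rw [Set.indicator_of_mem hy, Set.indicator_of_mem (join_mem_slab.2 ⟨ht, hy⟩)]; rfl
      · rw [Set.indicator_of_notMem hy,
          Set.indicator_of_notMem fun h => hy (join_mem_slab.1 h).2]
    · rw [Set.indicator_of_notMem ht]
      refine (lintegral_congr fun y => ?_).trans lintegral_zero
      exact Set.indicator_of_notMem (fun h => ht (join_mem_slab.1 h).1) _
  rw [lintegral_congr h1, lintegral_indicator_const measurableSet_Icc, Real.volume_Icc, sub_zero]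

/-- After rescaling the slab must lie where the cutoff in `x` equals `1`. Time uses up `1/4`, and
the choice of `κ` leaves at most `1/4` for the space coordinates together. -/
theorem norm_smul_le_of_mem_slab {d : ℕ} {K : ℝ} {k N : ℕ} (hN : 1 ≤ N)
    (hNK : K * (8 * (d + 1)) ≤ N) {x : E (d + 1)} (hx : x ∈ slab d (1 / (8 * (d + 1))) K k N) :
    ‖((N : ℝ) ^ 2)⁻¹ • x‖ ≤ 1 / 2 := by
  set κ : ℝ := 1 / (8 * (d + 1)) with hκ
  have hN1 : (1 : ℝ) ≤ N := by exact_mod_cast hN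
  have hκ0 : 0 < κ := by positivity
  obtain ⟨hx0, hx1⟩ := hx
  -- For large `N` the short sides `K` and `K * N` are also at most `κ * N ^ 2`.
  have hKκ : K ≤ κ * N := by
    rw [hκ, one_div_mul_eq_div, le_div_iff₀ (by positivity)]; exact hNK
  have heven : ∀ i : Fin d, Even (i : ℕ) → |x i.succ| ≤ κ * N ^ 2 := by
    intro i hi
    have := hx1 i
    simpa [Nat.not_odd_iff_even.2 hi, slabWidth, hi] using this
  have hall : ∀ i : Fin d, |x i.succ| ≤ 2 * (κ * N ^ 2) := by
    intro i
    rcases Nat.even_or_odd (i : ℕ) with hi | hi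
    · linarith [heven i hi, abs_nonneg (x i.succ)]
    · have h1 := hx1 i
      have hi' := Nat.not_even_iff_odd.2 hi
      have hpe : Even ((partner i : Fin d) : ℕ) := by
        rw [partner_of_odd hi]
        obtain ⟨m, hm⟩ := hi
        exact ⟨m, by omega⟩
      have h2 := heven _ hpe
      simp only [hi, if_true] at h1
      have h3 : slabWidth κ K k N i ≤ κ * N ^ 2 := by
        unfold slabWidth
        simp only [hi', if_false]
        split_ifs
        · refine hKκ.trans ?_
          gcongr
          exact le_self_pow₀ hN1 two_ne_zero
        · calc K * N ≤ κ * N * N := by gcongr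
            _ = κ * N ^ 2 := by ring
      set e : ℝ := Real.exp (-(((N : ℝ) ^ 2)⁻¹ * x 0)) with he
      have he1 : e ≤ 1 := by
        rw [he]
        refine Real.exp_le_one_iff.2 ?_
        have := hx0.1
        have : 0 ≤ ((N : ℝ) ^ 2)⁻¹ * x 0 := by positivity
        linarith
      have h4 : |e * x (partner i).succ| ≤ 1 * (κ * N ^ 2) := by
        rw [abs_mul, abs_of_pos (Real.exp_pos _)]
        gcongr
      have h5 := abs_sub_abs_le_abs_sub (x i.succ) (e * x (partner i).succ)
      linarith
  rw [norm_smul, norm_inv, Real.norm_of_nonneg (by positivity), inv_mul_le_iff₀ (by positivity)]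
  refine (norm_le_sum_abs x).trans ?_
  rw [Fin.sum_univ_succ, abs_of_nonneg hx0.1]
  have h6 : ∑ i : Fin d, |x i.succ| ≤ ∑ _i : Fin d, 2 * (κ * N ^ 2) :=
    Finset.sum_le_sum fun i _ => hall i
  rw [Finset.sum_const, Finset.card_univ, Fintype.card_fin, nsmul_eq_mul] at h6
  have h7 : (d : ℝ) * (2 * (κ * (N : ℝ) ^ 2)) ≤ (N : ℝ) ^ 2 / 4 := by
    have : (d : ℝ) * κ ≤ 1 / 8 := by
      rw [hκ, mul_one_div, div_le_div_iff₀ (by positivity) (by norm_num)]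
      linarith
    calc (d : ℝ) * (2 * (κ * (N : ℝ) ^ 2)) = (d * κ) * (2 * (N : ℝ) ^ 2) := by ring
      _ ≤ (1 / 8) * (2 * (N : ℝ) ^ 2) := by gcongr
      _ = (N : ℝ) ^ 2 / 4 := by ring
  linarith [hx0.2]

theorem norm_le_of_tileBump_ne_zero {d k N : ℕ} {c : ℝ} (hc : 0 < c) (hc1 : c ≤ 1 / (6 * (d + 1)))
    (hN : 1 ≤ N) {j : Fin d → ℕ} (hj : ∀ l : Fin d, j l < tileCount k N l) {ω : E d}
    (h : tileBump (tileCenter c k N j) (tileRadius c k N) ω ≠ 0) : ‖ω‖ ≤ 1 / 2 := by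
  have hb : ∀ l, |ω l| ≤ 3 * c := fun l => by
    have h2 := abs_sub_lt_of_tileBump_ne_zero (tileRadius_pos hc hN) h l
    have h3 := abs_tileCenter_le hc hN hj l
    have h4 := tileRadius_le (k := k) hc hN l
    have h5 := abs_sub_abs_le_abs_sub (ω l) (tileCenter c k N j l)
    linarith
  refine (norm_le_sum_abs ω).trans ((Finset.sum_le_sum fun l _ => hb l).trans ?_)
  rw [Finset.sum_const, Finset.card_univ, Fintype.card_fin, nsmul_eq_mul]
  rw [le_div_iff₀ (by positivity)] at hc1
  have : 0 ≤ (d : ℝ) := by positivity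
  nlinarith

/-! ### The operator applied to wave packets -/

/-- The input function of the wave packet with index `j`. -/
noncomputable def tileInput {d : ℕ} (c : ℝ) (k N : ℕ) (j : Fin d → ℕ) : E d → ℂ :=
  wavePacket (fun ω => -pairPhase k (tileCenter c k N j) ω) (N ^ 2) (tileCenter c k N j)
    (tileRadius c k N)

theorem continuous_tileInput {d : ℕ} (c : ℝ) (k N : ℕ) (j : Fin d → ℕ) :
    Continuous (tileInput c k N j) :=
  (contDiff_wavePacket (m := 0) (contDiff_pairPhase k _).neg _ _ _).continuous

/-- For fixed `t`, the function `T f (t, ·)` is an inverse Fourier transform. -/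
theorem T_tileInput {d k N : ℕ} {c : ℝ} (hc : 0 < c) (hc1 : c ≤ 1 / (6 * (d + 1)))
    (hN : 1 ≤ N) {j : Fin d → ℕ} (hj : ∀ l : Fin d, j l < tileCount k N l) (t : ℝ) (y : E d)
    (hx : ‖((N : ℝ) ^ 2)⁻¹ • join t y‖ ≤ 1 / 2) :
    T (phase d k) (amplitude d) ((N : ℝ) ^ 2) (tileInput c k N j) (join t y) =
      𝓕⁻ (wavePacket (tilePhase k (((N : ℝ) ^ 2)⁻¹ * t) (tileCenter c k N j)) (N ^ 2)
        (tileCenter c k N j) (tileRadius c k N)) y := by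
  have hN0 : ((N : ℝ) ^ 2) ≠ 0 := by
    have : (1 : ℝ) ≤ N := by exact_mod_cast hN
    positivity
  rw [Real.fourierInv_eq', T, setIntegral_eq_integral_of_forall_compl_eq_zero]
  · refine integral_congr_ae (Filter.Eventually.of_forall fun ω => ?_)
    by_cases hb : tileBump (tileCenter c k N j) (tileRadius c k N) ω = 0
    · simp [tileInput, wavePacket, hb]
    · have h1 : amplitude d (((N : ℝ) ^ 2)⁻¹ • join t y) ω = 1 := by
        simp [amplitude, cutoff_eq_one hx,
          cutoff_eq_one (norm_le_of_tileBump_ne_zero hc hc1 hN hj hb)]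
      -- Rescaling leaves `⟨y, ω⟩` unchanged and multiplies the quadratic part at time `τ = t / N²`
      -- by `N²`; the phase of the input then turns that part into `tilePhase`.
      have h2 : (N : ℝ) ^ 2 * phase d k (((N : ℝ) ^ 2)⁻¹ • join t y) ω =
          inner ℝ ω y + (N : ℝ) ^ 2 * (tilePhase k (((N : ℝ) ^ 2)⁻¹ * t) (tileCenter c k N j) ω +
            pairPhase k (tileCenter c k N j) ω) := by
        rw [tilePhase, sub_add_cancel, phase, mul_add, PiLp.inner_apply]
        simp only [PiLp.smul_apply, join_succ, join_zero, smul_eq_mul]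
        congr 1
        rw [Finset.mul_sum]
        refine Finset.sum_congr rfl fun l _ => ?_
        simp
        field_simp
      simp only [h1, mul_one, tileInput, wavePacket, smul_eq_mul, ← mul_assoc, ← Complex.exp_add]
      congr 2
      rw [h2]
      push_cast
      ring
  · intro ω hω
    have hb : tileBump (tileCenter c k N j) (tileRadius c k N) ω = 0 := by
      by_contra hb
      refine hω (mem_ball_zero_iff.2 ?_)
      linarith [norm_le_of_tileBump_ne_zero hc hc1 hN hj hb]
    simp [tileInput, wavePacket, hb]

theorem continuous_uncurry_kernel (d k : ℕ) (lam : ℝ) {f : E d → ℂ} (hf : Continuous f) :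
    Continuous fun z : E (d + 1) × E d =>
      Complex.exp (2 * Real.pi * Complex.I * ((lam * phase d k (lam⁻¹ • z.1) z.2 : ℝ) : ℂ)) *
        amplitude d (lam⁻¹ • z.1) z.2 * f z.2 := by
  have hs : Continuous fun z : E (d + 1) × E d => (lam⁻¹ • z.1, z.2) := by fun_prop
  have h1 : Continuous fun z : E (d + 1) × E d => phase d k (lam⁻¹ • z.1) z.2 :=
    (contDiff_phase d k (m := 0)).continuous.comp hs
  have h2 : Continuous fun z : E (d + 1) × E d => amplitude d (lam⁻¹ • z.1) z.2 :=
    (contDiff_amplitude d (m := 0)).continuous.comp hs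
  fun_prop

theorem measurable_T (d k : ℕ) (lam : ℝ) {f : E d → ℂ} (hf : Continuous f) :
    Measurable (T (phase d k) (amplitude d) lam f) :=
  ((continuous_uncurry_kernel d k lam hf).stronglyMeasurable.integral_prod_right').measurable

theorem integrableOn_ball_of_continuous {d : ℕ} {f : E d → ℂ} (hf : Continuous f) :
    IntegrableOn f (B d) :=
  (hf.continuousOn.integrableOn_compact (isCompact_closedBall 0 1)).mono_set
    Metric.ball_subset_closedBall

theorem integrableOn_kernel (d k : ℕ) (lam : ℝ) {f : E d → ℂ} (hf : Continuous f)
    (x : E (d + 1)) :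
    IntegrableOn (fun ω =>
      Complex.exp (2 * Real.pi * Complex.I * ((lam * phase d k (lam⁻¹ • x) ω : ℝ) : ℂ)) *
        amplitude d (lam⁻¹ • x) ω * f ω) (B d) := by
  have h := (continuous_uncurry_kernel d k lam hf).comp (Continuous.prodMk_right x)
  exact integrableOn_ball_of_continuous h

theorem T_sum (d k : ℕ) (lam : ℝ) {ι : Type*} (s : Finset ι) (ε : ι → ℂ) (f : ι → E d → ℂ)
    (hf : ∀ i, Continuous (f i)) (x : E (d + 1)) :
    T (phase d k) (amplitude d) lam (fun ω => ∑ i ∈ s, ε i * f i ω) x =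
      ∑ i ∈ s, ε i * T (phase d k) (amplitude d) lam (f i) x := by
  simp only [T, Finset.mul_sum, ← integral_const_mul]
  rw [← integral_finsetSum]
  · refine integral_congr_ae (Filter.Eventually.of_forall fun ω => ?_)
    refine Finset.sum_congr rfl fun i _ => ?_
    ring
  · intro i _
    exact Integrable.const_mul (integrableOn_kernel d k lam (hf i) x) _

/-- The bound `A` on each slice is integrated over a time interval of length `N ^ 2 / 4`; on the
slab the operator is exactly the inverse Fourier transform. -/
theorem le_lintegral_slab_T_tileInput {d k N : ℕ} {c K : ℝ} (hc : 0 < c)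
    (hc1 : c ≤ 1 / (6 * (d + 1))) (hN : 1 ≤ N) (hNK : K * (8 * (d + 1)) ≤ N)
    {j : Fin d → ℕ} (hj : ∀ l : Fin d, j l < tileCount k N l) {A : ℝ≥0∞}
    (hA : ∀ τ : ℝ, 0 ≤ τ → τ ≤ 1 → A ≤ ∫⁻ y in slice d (1 / (8 * (d + 1))) K k N τ,
      ‖𝓕⁻ (wavePacket (tilePhase k τ (tileCenter c k N j)) (N ^ 2) (tileCenter c k N j)
              (tileRadius c k N)) y‖ₑ ^ 2) :
    A * ENNReal.ofReal ((N : ℝ) ^ 2 / 4) ≤ ∫⁻ x in slab d (1 / (8 * (d + 1))) K k N,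
      ‖T (phase d k) (amplitude d) ((N : ℝ) ^ 2) (tileInput c k N j) x‖ₑ ^ 2 := by
  have hm := measurableSet_slab d (1 / (8 * (d + 1))) K k N
  have hN1 : (1 : ℝ) ≤ N := by exact_mod_cast hN
  rw [← lintegral_indicator hm, lintegral_eq_lintegral_join
    (((measurable_T d k _ (continuous_tileInput c k N j)).enorm.pow_const 2).indicator hm)]
  have h0 : A * ENNReal.ofReal ((N : ℝ) ^ 2 / 4) =
      ∫⁻ t, (Set.Icc 0 ((N : ℝ) ^ 2 / 4)).indicator (fun _ => A) t := by
    rw [lintegral_indicator_const measurableSet_Icc, Real.volume_Icc, sub_zero]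
  rw [h0]
  refine lintegral_mono fun t => ?_
  by_cases ht : t ∈ Set.Icc 0 ((N : ℝ) ^ 2 / 4)
  · rw [Set.indicator_of_mem ht]
    have ht0 := ht.1
    refine (hA (((N : ℝ) ^ 2)⁻¹ * t) (by positivity) ?_).trans ?_
    · rw [inv_mul_le_iff₀ (by positivity)]
      linarith [ht.2, sq_nonneg (N : ℝ)]
    · rw [← lintegral_indicator (isClosed_slice d _ K k N _).measurableSet]
      refine lintegral_mono fun y => ?_
      by_cases hy : y ∈ slice d (1 / (8 * (d + 1))) K k N (((N : ℝ) ^ 2)⁻¹ * t)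
      · have hmem := join_mem_slab.2 ⟨ht, hy⟩
        rw [Set.indicator_of_mem hy, Set.indicator_of_mem hmem,
          T_tileInput hc hc1 hN hj t y (norm_smul_le_of_mem_slab hN hNK hmem)]
      · rw [Set.indicator_of_notMem hy]
        exact zero_le
  · rw [Set.indicator_of_notMem ht]
    exact zero_le

/-! ### Superposition of the wave packets -/

/-- Signs can be chosen so that the `L²` mass of a signed sum is at least the sum of the
`L²` masses. -/
theorem exists_sign_sum_lintegral_le {α ι : Type*} [MeasurableSpace α] (μ : Measure α)
    (s : Finset ι) (F : ι → α → ℂ) (hF : ∀ i, Measurable (F i)) :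
    ∃ ε : ι → ℂ, (∀ i, ε i = 1 ∨ ε i = -1) ∧
      ∑ i ∈ s, ∫⁻ x, ‖F i x‖ₑ ^ 2 ∂μ ≤ ∫⁻ x, ‖∑ i ∈ s, ε i * F i x‖ₑ ^ 2 ∂μ := by
  classical
  induction s using Finset.induction_on with
  | empty => exact ⟨fun _ => 1, fun _ => Or.inl rfl, by simp⟩
  | insert a s ha ih =>
    obtain ⟨ε, hε, hle⟩ := ih
    set S : α → ℂ := fun x => ∑ i ∈ s, ε i * F i x with hS
    have hSm : Measurable S := Finset.measurable_sum _ fun i _ => (hF i).const_mul _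
    -- By the parallelogram law the average over the two signs of the new term is the sum of the
    -- masses, so one of the signs does at least as well.
    have hpar : ∀ x, ‖F a x + S x‖ₑ ^ 2 + ‖-F a x + S x‖ₑ ^ 2 =
        2 * (‖F a x‖ₑ ^ 2 + ‖S x‖ₑ ^ 2) := by
      intro x
      simp only [← ofReal_norm, ← ENNReal.ofReal_pow (norm_nonneg _)]
      rw [← ENNReal.ofReal_add (by positivity) (by positivity),
        ← ENNReal.ofReal_add (by positivity) (by positivity),
        ← ENNReal.ofReal_ofNat 2, ← ENNReal.ofReal_mul (by positivity)]
      congr 1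
      have := parallelogram_law_with_norm ℝ (S x) (F a x)
      rw [add_comm (F a x), neg_add_eq_sub]
      linarith
    have hint : ∫⁻ x, ‖F a x + S x‖ₑ ^ 2 ∂μ + ∫⁻ x, ‖-F a x + S x‖ₑ ^ 2 ∂μ =
        2 * (∫⁻ x, ‖F a x‖ₑ ^ 2 ∂μ + ∫⁻ x, ‖S x‖ₑ ^ 2 ∂μ) := by
      have hm : Measurable fun x => ‖F a x + S x‖ₑ ^ 2 := ((hF a).add hSm).enorm.pow_const 2
      rw [← lintegral_add_left hm,
        ← lintegral_add_left ((hF a).enorm.pow_const 2), lintegral_congr hpar,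
        lintegral_const_mul' _ _ ENNReal.ofNat_ne_top]
    obtain ⟨e, he, hbig⟩ : ∃ e : ℂ, (e = 1 ∨ e = -1) ∧
        ∫⁻ x, ‖F a x‖ₑ ^ 2 ∂μ + ∫⁻ x, ‖S x‖ₑ ^ 2 ∂μ ≤ ∫⁻ x, ‖e * F a x + S x‖ₑ ^ 2 ∂μ := by
      by_contra! hcon
      have h1 := hcon 1 (Or.inl rfl)
      have h2 := hcon (-1) (Or.inr rfl)
      simp only [one_mul, neg_mul] at h1 h2
      have h3 := ENNReal.add_lt_add h1 h2
      rw [hint, two_mul] at h3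
      exact lt_irrefl _ h3
    refine ⟨Function.update ε a e, fun i => ?_, ?_⟩
    · by_cases hi : i = a
      · subst hi; simpa using he
      · simpa [hi] using hε i
    · rw [Finset.sum_insert ha]
      refine (add_le_add le_rfl hle).trans (hbig.trans (le_of_eq ?_))
      refine lintegral_congr fun x => ?_
      rw [Finset.sum_insert ha, Function.update_self, hS]
      congr 3
      refine Finset.sum_congr rfl fun i hi => ?_
      rw [Function.update_of_ne (ne_of_mem_of_not_mem hi ha)]

/-- Distinct centres differ by at least `2 * tileRadius` in some coordinate, so at most one bump is
nonzero at each point. This keeps the superposed input bounded by `1`. -/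
theorem sum_tileBump_le_one {d k N : ℕ} {c : ℝ} (hc : 0 < c) (hN : 1 ≤ N) (s : Finset (Fin d → ℕ))
    (ω : E d) :
    ∑ j ∈ s, tileBump (tileCenter c k N j) (tileRadius c k N) ω ≤ 1 := by
  by_cases h : ∃ j ∈ s, tileBump (tileCenter c k N j) (tileRadius c k N) ω ≠ 0
  · obtain ⟨j, hjs, hj⟩ := h
    rw [Finset.sum_eq_single_of_mem j hjs]
    · exact tileBump_le_one _ _ _
    · intro i _ hij
      by_contra hi
      refine hij (funext fun l => ?_)
      have h1 := abs_lt.1 (abs_sub_lt_of_tileBump_ne_zero (tileRadius_pos hc hN) hi l)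
      have h2 := abs_lt.1 (abs_sub_lt_of_tileBump_ne_zero (tileRadius_pos hc hN) hj l)
      have hn : (0 : ℝ) < tileCount k N l := by exact_mod_cast tileCount_pos hN l
      have h3 : |tileCenter c k N i l - tileCenter c k N j l| < 2 * tileRadius c k N l := by
        rw [abs_lt]; constructor <;> linarith [h1.1, h1.2, h2.1, h2.2]
      have h4 : tileCenter c k N i l - tileCenter c k N j l =
          (2 * tileRadius c k N l) * ((i l : ℝ) - j l) := by
        unfold tileCenter tileRadius; ring
      have h5 : 0 < 2 * tileRadius c k N l := by
        have := tileRadius_pos (k := k) hc hN l; positivity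
      rw [h4, abs_mul, abs_of_pos h5, mul_lt_iff_lt_one_right h5] at h3
      have h6 : |(i l : ℤ) - j l| < 1 := by exact_mod_cast h3
      rw [Int.abs_lt_one_iff] at h6
      omega
  · push Not at h
    rw [Finset.sum_eq_zero h]
    exact zero_le_one

theorem prod_tileRadius (d : ℕ) (c : ℝ) (k N : ℕ) :
    ∏ i : Fin d, tileRadius c k N i = c ^ d / ∏ i : Fin d, (tileCount k N i : ℝ) := by
  simp [tileRadius, Finset.prod_div_distrib]

/-- The order of growth of the widths of the slab, as powers of `N`. -/
def slabExponent (k i : ℕ) : ℕ := if Even i then 2 else if i < 2 * k then 0 else 1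

theorem prod_slabWidth_le (d : ℕ) {κ K : ℝ} (hκ : 0 ≤ κ) (hK : 0 ≤ K) (k N : ℕ) :
    ∏ i : Fin d, (2 * slabWidth κ K k N i) ≤
      (2 * (κ + K)) ^ d * (N : ℝ) ^ (∑ i : Fin d, slabExponent k i) := by
  have h : ∀ i : Fin d, 2 * slabWidth κ K k N i ≤ (2 * (κ + K)) * (N : ℝ) ^ slabExponent k i := by
    intro i
    have h1 : slabWidth κ K k N i ≤ (κ + K) * (N : ℝ) ^ slabExponent k i := by
      unfold slabWidth slabExponent
      split_ifs
      · gcongr; linarith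
      · simp; linarith
      · rw [pow_one]; gcongr; linarith
    linarith
  calc ∏ i : Fin d, (2 * slabWidth κ K k N i)
      ≤ ∏ i : Fin d, ((2 * (κ + K)) * (N : ℝ) ^ slabExponent k i) :=
        Finset.prod_le_prod (fun i _ => by
          have := slabWidth_nonneg hκ hK k N i; positivity) fun i _ => h i
    _ = _ := by
        rw [Finset.prod_mul_distrib, Finset.prod_const, Finset.prod_pow_eq_pow_sum,
          Finset.card_univ, Fintype.card_fin]

/-- The main lower bound: bounded inputs whose images have large `L²` mass on a small set. -/
theorem exists_concentrated_input (d k : ℕ) :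
    ∃ c₀ C : ℝ, ∃ N₀ : ℕ, 0 < c₀ ∧ 0 < C ∧ ∀ N : ℕ, N₀ ≤ N → 1 ≤ N →
      ∃ (f : E d → ℂ) (U : Set (E (d + 1))), Continuous f ∧ (∀ ω, ‖f ω‖ ≤ 1) ∧
        MeasurableSet U ∧
        volume U ≤ ENNReal.ofReal (C * (N : ℝ) ^ (∑ i : Fin d, slabExponent k i + 2)) ∧
        ENNReal.ofReal (c₀ * (N : ℝ) ^ 2) ≤
          ∫⁻ x in U, ‖T (phase d k) (amplitude d) ((N : ℝ) ^ 2) f x‖ₑ ^ 2 := by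
  have hκ0 : (0 : ℝ) < 1 / (8 * (d + 1)) := by positivity
  obtain ⟨c, K, N₀, hc, hc1, hK, hmain⟩ := exists_half_le_lintegral_fourierInv_tile d k hκ0
  obtain ⟨N₁, hN₁⟩ := exists_nat_ge (K * (8 * (d + 1)))
  refine ⟨c ^ d / 8, (2 * (1 / (8 * (d + 1)) + K)) ^ d / 4, max N₀ N₁, by positivity,
    by positivity, fun N hN hN1 => ?_⟩
  have hNK : K * (8 * (d + 1)) ≤ N :=
    hN₁.trans (by exact_mod_cast (le_max_right _ _).trans hN)
  set s : Finset (Fin d → ℕ) := Fintype.piFinset fun i : Fin d => Finset.range (tileCount k N i)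
    with hs
  have hsj : ∀ j ∈ s, ∀ l : Fin d, j l < tileCount k N l := fun j hj l =>
    Finset.mem_range.1 (Fintype.mem_piFinset.1 hj l)
  set U := slab d (1 / (8 * (d + 1))) K k N with hU
  obtain ⟨ε, hε, hsum⟩ := exists_sign_sum_lintegral_le (volume.restrict U) s
    (fun j => T (phase d k) (amplitude d) ((N : ℝ) ^ 2) (tileInput c k N j))
    fun j => measurable_T d k _ (continuous_tileInput c k N j)
  refine ⟨fun ω => ∑ j ∈ s, ε j * tileInput c k N j ω, U, ?_, fun ω => ?_,
    measurableSet_slab _ _ _ _ _, ?_, ?_⟩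
  · exact continuous_finsetSum _ fun j _ => continuous_const.mul (continuous_tileInput c k N j)
  · refine (norm_sum_le _ _).trans (le_trans (le_of_eq ?_)
      (sum_tileBump_le_one (k := k) hc hN1 s ω))
    refine Finset.sum_congr rfl fun j _ => ?_
    have h1 : ‖ε j‖ = 1 := by rcases hε j with h | h <;> simp [h]
    rw [norm_mul, h1, one_mul, tileInput, norm_wavePacket]
  · rw [hU, volume_slab d hκ0.le hK.le, ← ENNReal.ofReal_mul' (by positivity)]
    refine ENNReal.ofReal_le_ofReal ?_
    have := prod_slabWidth_le d hκ0.le hK.le k N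
    calc _ ≤ (2 * (1 / (8 * (d + 1)) + K)) ^ d * (N : ℝ) ^ (∑ i : Fin d, slabExponent k i) *
          ((N : ℝ) ^ 2 / 4) := by gcongr
      _ = _ := by rw [pow_add]; ring
  · simp only [T_sum d k _ s ε _ fun j => continuous_tileInput c k N j]
    refine le_trans ?_ hsum
    have hpiece : ∀ j ∈ s, ENNReal.ofReal ((∏ i : Fin d, tileRadius c k N i) / 2) *
        ENNReal.ofReal ((N : ℝ) ^ 2 / 4) ≤ ∫⁻ x in U,
          ‖T (phase d k) (amplitude d) ((N : ℝ) ^ 2) (tileInput c k N j) x‖ₑ ^ 2 := fun j hj =>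
      le_lintegral_slab_T_tileInput hc hc1 hN1 hNK (hsj j hj)
        (hmain N ((le_max_left _ _).trans hN) hN1 j (hsj j hj))
    -- The number of tiles times the product of their radii is `c ^ d`, so the total mass does not
    -- depend on how finely the frequencies are cut.
    refine le_trans (le_of_eq ?_) (Finset.sum_le_sum hpiece)
    have hcard : (s.card : ℝ) = ∏ i : Fin d, (tileCount k N i : ℝ) := by
      rw [hs, Fintype.card_piFinset]
      simp
    have hpos : 0 < ∏ i : Fin d, (tileCount k N i : ℝ) :=
      Finset.prod_pos fun i _ => by exact_mod_cast tileCount_pos hN1 i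
    rw [Finset.sum_const, nsmul_eq_mul, ← ENNReal.ofReal_mul' (by positivity),
      ← ENNReal.ofReal_natCast, ← ENNReal.ofReal_mul (by positivity), hcard, prod_tileRadius]
    congr 1
    field_simp
    norm_num

/-! ### Exponents and the failure of the estimate -/

/-- A pair contributes `2 + 1`, or `2 + 0` if it is among the first `k`, and an unpaired last index
contributes `2`. Adding the saving back, in place of subtracting it, avoids truncated subtraction.
-/
theorem sum_slabExponent_add (k d : ℕ) :
    ∑ i : Fin d, slabExponent k i + min k (d / 2) = d + (d + 1) / 2 := by
  rw [Fin.sum_univ_eq_sum_range (slabExponent k) d]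
  induction d with
  | zero => simp
  | succ d ih =>
    rw [Finset.sum_range_succ]
    unfold slabExponent at ih ⊢
    rcases Nat.even_or_odd d with he | ho
    · simp only [he, if_true]
      obtain ⟨m, hm⟩ := he
      omega
    · simp only [Nat.not_even_iff_odd.2 ho, if_false]
      obtain ⟨m, hm⟩ := ho
      split_ifs <;> omega

theorem norm_T_le (d k : ℕ) (lam : ℝ) {f : E d → ℂ} (hf : ∀ ω, ‖f ω‖ ≤ 1) (x : E (d + 1)) :
    ‖T (phase d k) (amplitude d) lam f x‖ ≤ (volume (B d)).toReal := by
  have h : ∀ ω ∈ B d, ‖Complex.exp (2 * Real.pi * Complex.I *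
      ((lam * phase d k (lam⁻¹ • x) ω : ℝ) : ℂ)) * amplitude d (lam⁻¹ • x) ω * f ω‖ ≤ 1 := by
    intro ω _
    rw [norm_mul, norm_mul, norm_exp_two_pi_I_mul, one_mul]
    refine mul_le_one₀ ?_ (norm_nonneg _) (hf ω)
    rw [amplitude, Complex.norm_real, norm_mul, Real.norm_of_nonneg (cutoff _).nonneg,
      Real.norm_of_nonneg (cutoff _).nonneg]
    exact mul_le_one₀ (cutoff _).le_one (cutoff _).nonneg (cutoff _).le_one
  have := norm_setIntegral_le_of_norm_le_const (μ := volume) measure_ball_lt_top h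
  simpa [T, Measure.real] using this

theorem not_forall_mul_rpow_le {c A s e : ℝ} (hc : 0 < c) (he : e < s) (N₀ : ℕ) :
    ¬ ∀ N : ℕ, N₀ ≤ N → c * (N : ℝ) ^ s ≤ A * (N : ℝ) ^ e := by
  intro h
  have h1 : Filter.Tendsto (fun N : ℕ => A * (N : ℝ) ^ (-(s - e))) Filter.atTop (nhds (A * 0)) :=
    ((tendsto_rpow_neg_atTop (sub_pos.2 he)).comp tendsto_natCast_atTop_atTop).const_mul A
  rw [mul_zero] at h1
  refine absurd (ge_of_tendsto h1 ?_) (not_le.2 hc)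
  filter_upwards [Filter.eventually_ge_atTop N₀, Filter.eventually_ge_atTop 1] with N hN hN1
  have hpos : (0 : ℝ) < N := by exact_mod_cast hN1
  have h2 := h N hN
  have h3 : A * (N : ℝ) ^ (-(s - e)) = A * (N : ℝ) ^ e / (N : ℝ) ^ s := by
    rw [neg_sub, Real.rpow_sub hpos]; ring
  rw [h3, le_div_iff₀ (Real.rpow_pos_of_pos hpos s)]
  exact h2

theorem eLpNorm_restrict_ball_le {d : ℕ} {f : E d → ℂ} (hf : ∀ ω, ‖f ω‖ ≤ 1) (p : ℝ≥0∞) :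
    eLpNorm f p (volume.restrict (B d)) ≤ volume (B d) ^ p.toReal⁻¹ := by
  have h := eLpNorm_le_of_ae_bound (p := p) (μ := volume.restrict (B d))
    (Filter.Eventually.of_forall hf)
  simpa using h

/-- Hölder's inequality is replaced by the uniform bound on the image: `|F|² ≤ V^(2-p) |F|^p`, so
the mass `N²` forces a growth of the `L^p` norm that a small power of `λ` cannot supply. -/
theorem not_epsLossEstimate_of_le_two (d k : ℕ) {p : ℝ} (hp0 : 0 < p) (hp : p ≤ 2) :
    ¬ EpsLossEstimate (phase d k) (amplitude d) p := by
  intro hest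
  obtain ⟨c₀, _, N₀, hc₀, _, hmain⟩ := exists_concentrated_input d k
  -- With this `ε` the loss `λ ^ ε`, raised to the power `p`, is `N`, to be compared with `N ^ 2`.
  obtain ⟨C, hC0, hC⟩ := hest (1 / (2 * p)) (by positivity)
  set V : ℝ := (volume (B d)).toReal with hV
  have hVtop : volume (B d) ≠ ∞ := measure_ball_lt_top.ne
  have hV0 : 0 ≤ V := ENNReal.toReal_nonneg
  have hVe : volume (B d) = ENNReal.ofReal V := (ENNReal.ofReal_toReal hVtop).symm
  have hpt : (ENNReal.ofReal p).toReal = p := ENNReal.toReal_ofReal hp0.le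
  refine not_forall_mul_rpow_le (A := V ^ (2 - p) * (C * V ^ p⁻¹) ^ p) hc₀
    (show (1 : ℝ) < 2 by norm_num) (max N₀ 2) fun N hN => ?_
  have hN2 : 2 ≤ N := (le_max_right _ _).trans hN
  have hNpos : (0 : ℝ) < N := by exact_mod_cast (by omega : 0 < N)
  have hlam : 1 < (N : ℝ) ^ 2 := one_lt_pow₀ (by exact_mod_cast hN2) two_ne_zero
  obtain ⟨f, U, hfc, hf1, _, _, hlow⟩ := hmain N ((le_max_left _ _).trans hN) (by omega)
  have hup := hC _ hlam f (integrableOn_ball_of_continuous hfc)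
  set F := T (phase d k) (amplitude d) ((N : ℝ) ^ 2) f with hF
  have hup2 : eLpNorm F (ENNReal.ofReal p) volume ≤
      ENNReal.ofReal (C * V ^ p⁻¹ * (N : ℝ) ^ p⁻¹) := by
    refine hup.trans ?_
    have h1 := eLpNorm_restrict_ball_le hf1 (ENNReal.ofReal p)
    rw [hpt, hVe, ENNReal.ofReal_rpow_of_nonneg hV0 (by positivity)] at h1
    refine (mul_le_mul_right h1 _).trans ?_
    rw [← ENNReal.ofReal_mul (by positivity), ← Real.rpow_natCast, ← Real.rpow_mul hNpos.le]
    refine ENNReal.ofReal_le_ofReal (le_of_eq ?_)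
    have : ((2 : ℕ) : ℝ) * (1 / (2 * p)) = p⁻¹ := by push_cast; field_simp
    rw [this]; ring
  have hint : ∫⁻ x, ‖F x‖ₑ ^ p = eLpNorm F (ENNReal.ofReal p) volume ^ p := by
    rw [eLpNorm_eq_lintegral_rpow_enorm_toReal (by simpa using hp0) ENNReal.ofReal_ne_top, hpt,
      ← ENNReal.rpow_mul, one_div, inv_mul_cancel₀ hp0.ne', ENNReal.rpow_one]
  have hpt2 : ∀ x, ‖F x‖ₑ ^ 2 ≤ ENNReal.ofReal (V ^ (2 - p)) * ‖F x‖ₑ ^ p := by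
    intro x
    have h1 : ‖F x‖ₑ ^ 2 = ‖F x‖ₑ ^ (2 - p) * ‖F x‖ₑ ^ p := by
      rw [← ENNReal.rpow_add_of_nonneg _ _ (by linarith) hp0.le, sub_add_cancel,
        ← ENNReal.rpow_natCast]
      norm_num
    rw [h1, ← ENNReal.ofReal_rpow_of_nonneg hV0 (by linarith)]
    gcongr
    rw [← ofReal_norm]
    exact ENNReal.ofReal_le_ofReal (norm_T_le d k _ hf1 x)
  have hfin : ENNReal.ofReal (c₀ * (N : ℝ) ^ 2) ≤
      ENNReal.ofReal (V ^ (2 - p) * (C * V ^ p⁻¹ * (N : ℝ) ^ p⁻¹) ^ p) := by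
    refine hlow.trans ((setLIntegral_le_lintegral _ _).trans ((lintegral_mono hpt2).trans ?_))
    rw [lintegral_const_mul' _ _ ENNReal.ofReal_ne_top, hint, ENNReal.ofReal_mul (by positivity),
      ← ENNReal.ofReal_rpow_of_nonneg (by positivity) hp0.le]
    gcongr
  rw [ENNReal.ofReal_le_ofReal_iff (by positivity),
    Real.mul_rpow (by positivity) (by positivity), ← Real.rpow_mul hNpos.le,
    inv_mul_cancel₀ hp0.ne', ← mul_assoc] at hfin
  exact_mod_cast hfin

/-- Hölder on the slab gives the contradiction; `hpP` says exactly that `(P + 2) * (1/2 - 1/p) < 1`.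
-/
theorem not_epsLossEstimate_of_two_lt (d k : ℕ) {p : ℝ} (hp : 2 < p) {P : ℝ}
    (hP : P = (∑ i : Fin d, slabExponent k i : ℕ)) (hpP : p * P < 2 * (P + 2)) :
    ¬ EpsLossEstimate (phase d k) (amplitude d) p := by
  intro hest
  obtain ⟨c₀, C₁, N₀, hc₀, hC₁, hmain⟩ := exists_concentrated_input d k
  have hp0 : 0 < p := by linarith
  set s : ℝ := 1 / 2 - 1 / p with hs
  have hs0 : 0 ≤ s := by
    rw [hs, sub_nonneg]
    exact one_div_le_one_div_of_le (by norm_num) hp.le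
  have hsP : (P + 2) * s < 1 := by
    have h1 : (P + 2) * s = ((P + 2) * (p - 2)) / (2 * p) := by rw [hs]; field_simp
    rw [h1, div_lt_one (by positivity)]
    linarith
  -- With `λ = N ^ 2` the upper bound has exponent `2 * ε + (P + 2) * s`, which this choice places
  -- midway between `(P + 2) * s` and `1`.
  set ε : ℝ := (1 - (P + 2) * s) / 4 with hε
  obtain ⟨C, hC0, hC⟩ := hest ε (by rw [hε]; linarith)
  set V : ℝ := (volume (B d)).toReal with hV
  have hVtop : volume (B d) ≠ ∞ := measure_ball_lt_top.ne
  have hV0 : 0 ≤ V := ENNReal.toReal_nonneg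
  have hVe : volume (B d) = ENNReal.ofReal V := (ENNReal.ofReal_toReal hVtop).symm
  have hpt : (ENNReal.ofReal p).toReal = p := ENNReal.toReal_ofReal hp0.le
  refine not_forall_mul_rpow_le (A := C * V ^ p⁻¹ * C₁ ^ s) (e := 2 * ε + (P + 2) * s) (s := 1)
    (Real.sqrt_pos.2 hc₀) (by rw [hε]; linarith) (max N₀ 2) fun N hN => ?_
  have hN2 : 2 ≤ N := (le_max_right _ _).trans hN
  have hNpos : (0 : ℝ) < N := by exact_mod_cast (by omega : 0 < N)
  have hlam : 1 < (N : ℝ) ^ 2 := one_lt_pow₀ (by exact_mod_cast hN2) two_ne_zero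
  obtain ⟨f, U, hfc, hf1, hUm, hUvol, hlow⟩ := hmain N ((le_max_left _ _).trans hN) (by omega)
  have hup := hC _ hlam f (integrableOn_ball_of_continuous hfc)
  set F := T (phase d k) (amplitude d) ((N : ℝ) ^ 2) f with hF
  have hFm : Measurable F := measurable_T d k _ hfc
  have hup2 : eLpNorm F (ENNReal.ofReal p) volume ≤
      ENNReal.ofReal (C * V ^ p⁻¹ * (N : ℝ) ^ (2 * ε)) := by
    refine hup.trans ?_
    have h1 := eLpNorm_restrict_ball_le hf1 (ENNReal.ofReal p)
    rw [hpt, hVe, ENNReal.ofReal_rpow_of_nonneg hV0 (by positivity)] at h1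
    refine (mul_le_mul_right h1 _).trans ?_
    rw [← ENNReal.ofReal_mul (by positivity), ← Real.rpow_natCast, ← Real.rpow_mul hNpos.le]
    refine ENNReal.ofReal_le_ofReal (le_of_eq ?_)
    push_cast
    ring
  have hlow2 : ENNReal.ofReal (Real.sqrt c₀ * N) ≤ eLpNorm F 2 (volume.restrict U) := by
    rw [eLpNorm_eq_lintegral_rpow_enorm_toReal two_ne_zero ENNReal.ofNat_ne_top]
    have h1 : ENNReal.ofReal (Real.sqrt c₀ * N) =
        ENNReal.ofReal (c₀ * (N : ℝ) ^ 2) ^ (1 / (2 : ℝ)) := by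
      rw [ENNReal.ofReal_rpow_of_nonneg (by positivity) (by norm_num), ← Real.sqrt_eq_rpow,
        Real.sqrt_mul hc₀.le, Real.sqrt_sq hNpos.le]
    rw [h1]
    simp only [ENNReal.toReal_ofNat, ENNReal.rpow_ofNat]
    exact ENNReal.rpow_le_rpow hlow (by norm_num)
  have hholder : eLpNorm F 2 (volume.restrict U) ≤
      eLpNorm F (ENNReal.ofReal p) volume * volume U ^ s := by
    have h1 := eLpNorm_le_eLpNorm_mul_rpow_measure_univ (μ := volume.restrict U) (f := F)
      (p := 2) (q := ENNReal.ofReal p)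
      (by rw [← ENNReal.ofReal_ofNat 2]; exact ENNReal.ofReal_le_ofReal hp.le)
      hFm.aestronglyMeasurable
    rw [hpt, Measure.restrict_apply_univ, ENNReal.toReal_ofNat] at h1
    refine h1.trans ?_
    gcongr
    exact Measure.restrict_le_self
  have hvol : volume U ^ s ≤ ENNReal.ofReal (C₁ ^ s * (N : ℝ) ^ ((P + 2) * s)) := by
    refine (ENNReal.rpow_le_rpow hUvol hs0).trans (le_of_eq ?_)
    rw [ENNReal.ofReal_rpow_of_nonneg (by positivity) hs0,
      Real.mul_rpow hC₁.le (by positivity), ← Real.rpow_natCast, ← Real.rpow_mul hNpos.le, hP]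
    push_cast
    rfl
  have hfin : ENNReal.ofReal (Real.sqrt c₀ * N) ≤ ENNReal.ofReal
      (C * V ^ p⁻¹ * (N : ℝ) ^ (2 * ε) * (C₁ ^ s * (N : ℝ) ^ ((P + 2) * s))) := by
    refine (hlow2.trans (hholder.trans (mul_le_mul' hup2 hvol))).trans (le_of_eq ?_)
    exact (ENNReal.ofReal_mul (by positivity)).symm
  rw [ENNReal.ofReal_le_ofReal_iff (by positivity)] at hfin
  rw [Real.rpow_one, Real.rpow_add hNpos]
  calc Real.sqrt c₀ * N ≤ _ := hfin
    _ = _ := by ring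

/-- For `k = (n - 1 - σ)/2`, twice the sum of the exponents is `σ + 2n - 2` for odd `n` and `σ + 2n
- 1` for even `n`, the difference being due to the unpaired coordinate. In both cases the critical
exponent is `2 (P + 2) / P`. -/
theorem mul_sum_slabExponent_lt {n σ : ℕ} (hn : 2 ≤ n) (hσ : σ ≤ n - 1) (hpar : Even (n - 1 - σ))
    {p P : ℝ} (hP : P = (∑ i : Fin (n - 1), slabExponent ((n - 1 - σ) / 2) i : ℕ))
    (hp : p < criticalExponent n σ) : p * P < 2 * (P + 2) := by
  have hsum := sum_slabExponent_add ((n - 1 - σ) / 2) (n - 1)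
  set S := ∑ i : Fin (n - 1), slabExponent ((n - 1 - σ) / 2) i with hS
  obtain ⟨m, hm⟩ := hpar
  have hn' : (2 : ℝ) ≤ n := by exact_mod_cast hn
  have hσ0 : (0 : ℝ) ≤ σ := Nat.cast_nonneg _
  unfold criticalExponent at hp
  split_ifs at hp with hodd
  · have h1 : 2 * S + 2 = σ + 2 * n := by
      obtain ⟨l, hl⟩ := hodd
      omega
    have h2 : 2 * P + 2 = σ + 2 * n := by rw [hP]; exact_mod_cast h1
    have h3 : (0 : ℝ) < σ + 2 * ((n : ℝ) - 1) := by linarith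
    rw [← mul_div_assoc, lt_div_iff₀ h3] at hp
    have h4 : (σ : ℝ) + 2 * ((n : ℝ) - 1) = 2 * P := by linarith
    have h5 : (σ : ℝ) + 2 * ((n : ℝ) + 1) = 2 * P + 4 := by linarith
    rw [h4, h5] at hp
    linarith
  · have h1 : 2 * S + 1 = σ + 2 * n := by
      obtain ⟨l, hl⟩ := Nat.not_odd_iff_even.1 hodd
      omega
    have h2 : 2 * P + 1 = σ + 2 * n := by rw [hP]; exact_mod_cast h1
    have h3 : (0 : ℝ) < σ + 2 * (n : ℝ) - 1 := by linarith
    rw [← mul_div_assoc, lt_div_iff₀ h3] at hp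
    have h4 : (σ : ℝ) + 2 * (n : ℝ) - 1 = 2 * P := by linarith
    have h5 : (σ : ℝ) + 2 * (n : ℝ) + 3 = 2 * P + 4 := by linarith
    rw [h4, h5] at hp
    linarith

end HormanderOperator

theorem proposition1p2 (n : ℕ) (hn : 2 ≤ n) (σ : ℕ) (hσ : σ ≤ n - 1) (hpar : Even (n - 1 - σ)) :
    ∃ (φ : HormanderOperator.E (n - 1 + 1) → HormanderOperator.E (n - 1) → ℝ)
      (a : HormanderOperator.E (n - 1 + 1) → HormanderOperator.E (n - 1) → ℂ),
      HormanderOperator.IsHormanderType φ a ∧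
      HormanderOperator.HasSignature φ σ ∧
      ∀ p : ℝ, 0 < p → ¬ (HormanderOperator.criticalExponent n σ ≤ p) →
        ¬ HormanderOperator.EpsLossEstimate φ a p := by
  refine ⟨HormanderOperator.phase (n - 1) ((n - 1 - σ) / 2), HormanderOperator.amplitude (n - 1),
    HormanderOperator.isHormanderType_phase_amplitude _ _,
    HormanderOperator.hasSignature_phase _ _ _ ?_, fun p hp0 hp => ?_⟩
  · obtain ⟨m, hm⟩ := hpar
    omega
  · rcases le_or_gt p 2 with h2 | h2
    · exact HormanderOperator.not_epsLossEstimate_of_le_two _ _ hp0 h2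
    · exact HormanderOperator.not_epsLossEstimate_of_two_lt _ _ h2 rfl
        (HormanderOperator.mul_sum_slabExponent_lt hn hσ hpar rfl (not_le.1 hp))
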